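/- Let $\mathfrak S_N$ be the set of permutations $\pi=\pi_1\pi_2\cdots\pi_N$ of $\{1,\dots,N\}$. Let $g,\ell\ge 1$ and $m\geq 1$. For a word $\pi=\pi_1\cdots\pi_N$ put $$g\mathsf{Excp}_m(\pi)=\{i : \pi_i\ge i+g,\ \pi_i\ge m\},\qquad g\mathsf{Excl}_m(\pi)=\{\pi_i : i\in g\mathsf{Excp}_m(\pi)\},\qquad g\mathsf{exc}_\ell(\pi)=|\{i : \pi_i\ge i+g,\ i\ge \ell\}|,$$ $$g\mathsf{den}_m(\pi)=\sum_{i\in g\mathsf{Excp}_m(\pi)}(i+g-1)+\mathsf{inv}(g\mathsf{Exc}_m(\pi))+\mathsf{inv}(g\mathsf{Nexc}_m(\pi)),$$ where $g\mathsf{Exc}_m(\pi)$ (resp. $g\mathsf{Nexc}_m(\pi)$) is the subword of $\pi$ formed by the letters at the places in (resp. not in) $g\mathsf{Excp}_m(\pi)$, and $\mathsf{inv}$ is the number of inversions. Fix $g,\ell\ge1$ and $n\ge g+\ell$. For $\pi\in\mathfrak S_{n-1}$ let $g\mathsf{Excl}_{g+\ell}(\pi)=\{e_1<\cdots<e_s\}$,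 $e_{s+1}=n$, and $$\mathcal A=\{i<\ell : \pi_i\in g\mathsf{Excl}_{g+\ell}(\pi)\},\qquad \mathcal B^*=\{i<\ell : \pi_i\notin g\mathsf{Excl}_{g+\ell}(\pi)\}.$$ Label the $n$ spaces of the index sequence $12\cdots(n-1)$ with $0,\dots,n-1$ as follows: the rightmost $g$ spaces get $0,1,\dots,g-1$ from right to left; the space before the index $e_i-(g-1)$ gets $g+s-i$ $(1\le i\le s)$; the spaces before the indices in $\mathcal B^*$ get $g+s,\dots,g\mathsf{exc}_\ell(\pi)+g+\ell-2$ from left to right; the remaining spaces get $g\mathsf{exc}_\ell(\pi)+g+\ell-1,\dots,n-1$ from left to right. For $0\le c\le n-1$ let $x$ be the index immediately after the space labelled $c$ (for $c=0$ this space is the one after the index $n-1$, and we put $x=n$). Define a word $\psi(\pi,c)$ of length $n$ as follows. * ($\alpha$) Suppose $x\in\mathcal A=\{i_1<\cdots<i_k\}$, $x=i_y$. Replace simultaneously every $e_j$, $1\le j\le s$, in $\pi$ by $e_{j+1}$ to obtain $\sigma$. Then $\psi(\pi,c)$ is obtained from $\sigma$ by replacing $\sigma_{x}$ by $e_1$,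 replacing $\sigma_{i_j}$ by $\sigma_{i_{j-1}}$ for $y<j\le k$, and inserting $\sigma_{i_k}$ immediately before $\sigma_\ell$. * ($\beta^*$) Suppose $x\in\mathcal B^*=\{i_1<\cdots<i_k\}$, $x=i_y$. Apply to $\pi$ the procedure of ($\alpha$), with this $i_1,\dots,i_k$ and $y$, to obtain a word $\theta=\theta_1\cdots\theta_n$. Let $e'_1<\cdots<e'_r$ be the letters $\theta_i$ with $i\in g\mathsf{Excp}_{g+\ell}(\theta)$ and $i<\ell$. Then $\psi(\pi,c)$ is obtained from $\theta$ by replacing $e'_j$ by $e'_{j-1}$ for $1<j\le r$ and $e'_1$ by $e'_r$. * ($\delta$) Otherwise ($c=0$ or $x\ge\ell$) let $e_y$ be the smallest of $e_1,\dots,e_{s}$ with $x\le e_y-(g-1)$, and let $y=s+1$ if there is none. Replace simultaneously every $e_j$, $y\le j\le s$, in $\pi$ by $e_{j+1}$ to obtain $\sigma$; then $\psi(\pi,c)$ is obtained from $\sigma$ by inserting $e_y$ immediately before $\sigma_x$ (at the end, if $x=n$). Theorem. For all $g,\ell\ge1$ and $n\ge g+\ell$, the words $\psi(\pi,c)$ are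 permutations of $\{1,\dots,n\}$, the map $$\psi:\mathfrak S_{n-1}\times\{0,1,\dots,n-1\}\longrightarrow\mathfrak S_n$$ is a bijection, and for all $\pi\in\mathfrak S_{n-1}$ and $0\le c\le n-1$, $$g\mathsf{exc}_\ell(\psi(\pi,c))=\begin{cases}g\mathsf{exc}_\ell(\pi)&\text{if }0\le c\le g\mathsf{exc}_\ell(\pi)+g+\ell-2,\\ g\mathsf{exc}_\ell(\pi)+1&\text{otherwise,}\end{cases}\qquad g\mathsf{den}_{g+\ell}(\psi(\pi,c))=g\mathsf{den}_{g+\ell}(\pi)+c.$$ -/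

import Mathlib

namespace GapDenert

/-- The one-line notation `π₁ π₂ ⋯ π_N` of a permutation, with places and letters numbered from
`1`; the value is `0` at every other place. -/
def oneLine {N : ℕ} (π : Equiv.Perm (Fin N)) (i : ℕ) : ℕ :=
  if h : 1 ≤ i ∧ i ≤ N then (π ⟨i - 1, by omega⟩ : ℕ) + 1 else 0

/-! ### Statistics of a word `w = w₁ w₂ ⋯ w_N` -/

/-- The set of `g`-gap `ℓ`-level excedance places. -/
def Excp (g ℓ N : ℕ) (w : ℕ → ℕ) : Finset ℕ :=
  {i ∈ Finset.Icc 1 N | i + g ≤ w i ∧ ℓ ≤ w i}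

/-- The set of the other places. -/
def Nexcp (g ℓ N : ℕ) (w : ℕ → ℕ) : Finset ℕ :=
  Finset.Icc 1 N \ Excp g ℓ N w

/-- The set of `g`-gap `ℓ`-level excedance letters. -/
def Excl (g ℓ N : ℕ) (w : ℕ → ℕ) : Finset ℕ :=
  (Excp g ℓ N w).image w

/-- The number of inversions of the subword of `w` formed by the letters at the places in `S`,
in the order in which they occur in `w`. -/
def invOn (w : ℕ → ℕ) (S : Finset ℕ) : ℕ :=
  ({p ∈ S ×ˢ S | p.1 < p.2 ∧ w p.2 < w p.1} : Finset _).card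

/-- The `g`-gap `ℓ`-level Denert statistic. -/
def den (g ℓ N : ℕ) (w : ℕ → ℕ) : ℕ :=
  (∑ i ∈ Excp g ℓ N w, (i + g - 1)) + invOn w (Excp g ℓ N w) + invOn w (Nexcp g ℓ N w)

/-- The `g`-gap `ℓ`-level excedance number. -/
def exc (g ℓ N : ℕ) (w : ℕ → ℕ) : ℕ :=
  ({i ∈ Finset.Icc 1 N | i + g ≤ w i ∧ ℓ ≤ i} : Finset _).card

/-! ### The labelling of the spaces

Throughout, `w` is the one-line notation of a permutation of `{1, …, n - 1}`. The `n` spaces of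
the index sequence `1 2 ⋯ (n - 1)` are numbered `1, …, n`: for `x < n` the space `x` is the one
immediately before the index `x`, and the space `n` is the one after the index `n - 1`. -/

/-- The places to the left of `ℓ` that carry a `g`-gap `(g+ℓ)`-level excedance letter. -/
def setA (g ℓ n : ℕ) (w : ℕ → ℕ) : Finset ℕ :=
  {i ∈ Finset.Icc 1 (n - 1) | w i ∈ Excl g (g + ℓ) (n - 1) w ∧ i < ℓ}

/-- The places to the left of `ℓ` that do not carry a `g`-gap `(g+ℓ)`-level excedance letter. -/
def setB (g ℓ n : ℕ) (w : ℕ → ℕ) : Finset ℕ :=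
  {i ∈ Finset.Icc 1 (n - 1) | w i ∉ Excl g (g + ℓ) (n - 1) w ∧ i < ℓ}

/-- The spaces that are not among the rightmost `g` spaces, are not immediately before an index
`e - (g - 1)` with `e` an excedance letter, and are not immediately before an index in `setB`. -/
def remainingSpaces (g ℓ n : ℕ) (w : ℕ → ℕ) : Finset ℕ :=
  {x ∈ Finset.Icc 1 (n - g) | x + (g - 1) ∉ Excl g (g + ℓ) (n - 1) w ∧ x ∉ setB g ℓ n w}

/-- The label of the space `x` in the `g`-gap-`(g+ℓ)`-level-den-labelling. If
`e₁ < ⋯ < e_s` are the excedance letters and `e_i = x + (g - 1)`, then the number of larger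
excedance letters is `s - i`. -/
def label (g ℓ n : ℕ) (w : ℕ → ℕ) (x : ℕ) : ℕ :=
  if n - g < x then n - x
  else if x + (g - 1) ∈ Excl g (g + ℓ) (n - 1) w then
    g + ({e ∈ Excl g (g + ℓ) (n - 1) w | x + (g - 1) < e} : Finset _).card
  else if x ∈ setB g ℓ n w then
    g + (Excl g (g + ℓ) (n - 1) w).card + ({j ∈ setB g ℓ n w | j < x} : Finset _).card
  else
    exc g ℓ (n - 1) w + g + ℓ - 1 + ({j ∈ remainingSpaces g ℓ n w | j < x} : Finset _).card

/-- The space with label `c`. -/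
def space (g ℓ n : ℕ) (w : ℕ → ℕ) (c : ℕ) : ℕ :=
  ({x ∈ Finset.Icc 1 n | label g ℓ n w x = c}).min.untopD n

/-- The insertion letter of the space `x`, for `x ≥ ℓ`: the smallest excedance letter `e` for
which the space `x` is to the left of the index `e - (g - 1)`, and `n` if there is none. -/
def insertionLetter (g ℓ n : ℕ) (w : ℕ → ℕ) (x : ℕ) : ℕ :=
  ({e ∈ Excl g (g + ℓ) (n - 1) w | x + (g - 1) ≤ e}).min.untopD n

/-! ### The maps -/

/-- With `e₁ < ⋯ < e_s` the excedance letters and `e_{s+1} = n`, the word obtained from `w` by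
replacing every `e_j ≥ a` with `e_{j+1}`. -/
def raise (g ℓ n : ℕ) (w : ℕ → ℕ) (a : ℕ) (i : ℕ) : ℕ :=
  if w i ∈ Excl g (g + ℓ) (n - 1) w ∧ a ≤ w i then
    ({e ∈ Excl g (g + ℓ) (n - 1) w | w i < e}).min.untopD n
  else w i

/-- The smallest excedance letter, and `n` if there is none. -/
def firstLetter (g ℓ n : ℕ) (w : ℕ → ℕ) : ℕ :=
  (Excl g (g + ℓ) (n - 1) w).min.untopD n

/-- The word obtained from `v` by inserting the letter `a` immediately before `v_x`. -/
def insertBefore (v : ℕ → ℕ) (x a : ℕ) (i : ℕ) : ℕ :=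
  if i < x then v i else if i = x then a else v (i - 1)

/-- For a set `S = {i₁ < ⋯ < i_k}` of places to the left of `ℓ` and `x = i_y`: the word obtained
from `v` by replacing `v_x` with `a`, replacing `v_{i_j}` with `v_{i_{j-1}}` for `y < j ≤ k`, and
inserting `v_{i_k}` immediately before `v_ℓ`. -/
def shiftInsert (ℓ : ℕ) (S : Finset ℕ) (x a : ℕ) (v : ℕ → ℕ) : ℕ → ℕ :=
  insertBefore
    (fun i => if i = x then a
      else if i ∈ S ∧ x < i then v (({j ∈ S | j < i}).max.unbotD 0)
      else v i)
    ℓ (v (S.max.unbotD 0))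

/-- With `e'₁ < ⋯ < e'_m` the `g`-gap `(g+ℓ)`-level excedance letters of the word
`v = v₁ ⋯ v_n` at places to the left of `ℓ`, the word obtained by replacing `e'_j` with
`e'_{j-1}` for `1 < j ≤ m` and `e'₁` with `e'_m`. -/
def rotate (g ℓ n : ℕ) (v : ℕ → ℕ) (i : ℕ) : ℕ :=
  let E := ({j ∈ Excp g (g + ℓ) n v | j < ℓ}).image v
  if v i ∈ E then ({e ∈ E | e < v i}).max.unbotD (E.max.unbotD 0) else v i

/-- The map `α`, used when the space labelled `c` is before an index in `setA`. -/
def alpha (g ℓ n : ℕ) (w : ℕ → ℕ) (c : ℕ) : ℕ → ℕ :=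
  shiftInsert ℓ (setA g ℓ n w) (space g ℓ n w c) (firstLetter g ℓ n w) (raise g ℓ n w 0)

/-- The map `β*`, used when the space labelled `c` is before an index in `setB`. -/
def betaStar (g ℓ n : ℕ) (w : ℕ → ℕ) (c : ℕ) : ℕ → ℕ :=
  rotate g ℓ n
    (shiftInsert ℓ (setB g ℓ n w) (space g ℓ n w c) (firstLetter g ℓ n w) (raise g ℓ n w 0))

/-- The map `δ`, used when `c = 0` or the space labelled `c` is before an index `x ≥ ℓ`. For
`c = 0` the space is the last one, and `n` is appended to `w`. -/
def delta (g ℓ n : ℕ) (w : ℕ → ℕ) (c : ℕ) : ℕ → ℕ :=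
  let x := space g ℓ n w c
  let a := insertionLetter g ℓ n w x
  insertBefore (raise g ℓ n w a) x a

/-- The map `ψ`, as a map to words. -/
def psi (g ℓ n : ℕ) (w : ℕ → ℕ) (c : ℕ) : ℕ → ℕ :=
  if space g ℓ n w c ∈ setA g ℓ n w then alpha g ℓ n w c
  else if space g ℓ n w c ∈ setB g ℓ n w then betaStar g ℓ n w c
  else delta g ℓ n w c

end GapDenert

/-! Write n = N + 1. The map δ, the map α, and β* before its final rotation are all instances of one
operation, `IsInsertion`. A set T of places containing every place from ℓ on is bumped from x, so
that x becomes free. The set E of excedance letters of level g + ℓ is bumped from a, with n entering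
at the top, so that a becomes free. Then a is put at x. Here T adds to [ℓ, N] nothing for δ, the low
excedance places A for α, and the other low places B for β*; "low" means left of ℓ.

An insertion never changes whether an old letter is an excedance (`bump_mem_Excp`). A low excedance
moves at most to ℓ, while its letter is at least g + ℓ. An excedance from ℓ on that moves one step
right also gets a larger letter. A non-excedance keeps its letter and never moves left. Inversions
within each of the two classes survive as well, so den changes only through the shifts of the
excedance places and through the pairs that involve x (`den_of_le`, `den_of_lt`). Counting these
gives the label of x for δ and α (`den_delta`, `den_alpha`). For β* the count is off by the number
of places of A right of x minus the number left of x. The rotation turns the letter at x from the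
smallest low excedance letter into the largest and preserves the order of the others, which corrects
exactly this (`den_betaStar`). The labels of the n spaces are distinct and less than n (`label_inj`,
`label_lt`), so every c is the label of one space.

Injectivity suffices, since (n-1)! · n = n!. A word is recovered from its image once T, x and a are
known (`word_unique`, `Excl_eq`). Under δ, either n is no excedance letter of the image and a = n,
or x is the anchor with the largest letter (`delta_anchor`). Images under α and β* have n as an
excedance letter and no anchor (`not_isAnchor`), and they differ from each other in whether ℓ is an
excedance place. For them a is the smallest excedance letter before rotation, which gives x, and the
low excedance places give A or B. -/

namespace GapDenert

open Finset

/-! ### Words -/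

/-- The word `w` is the one-line notation of a permutation of `{1, …, N}`, extended by `0`. -/
structure IsWord (N : ℕ) (w : ℕ → ℕ) : Prop where
  pos : ∀ i, 1 ≤ i → i ≤ N → 1 ≤ w i
  le : ∀ i, 1 ≤ i → i ≤ N → w i ≤ N
  inj : ∀ i j, 1 ≤ i → i ≤ N → 1 ≤ j → j ≤ N → w i = w j → i = j
  zero : ∀ i, i = 0 ∨ N < i → w i = 0

lemma oneLine_isWord {N : ℕ} (π : Equiv.Perm (Fin N)) : IsWord N (oneLine π) where
  pos i h1 h2 := by simp [oneLine, h1, h2]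
  le i h1 h2 := by
    simp only [oneLine, h1, h2, and_self, dite_true]
    exact (π _).2
  inj i j h1 h2 h3 h4 h := by
    simp only [oneLine, h1, h2, h3, h4, and_self, dite_true, Nat.add_right_cancel_iff] at h
    have := π.injective (Fin.ext h)
    simp only [Fin.mk.injEq] at this
    omega
  zero i h := by
    rw [oneLine, dif_neg]
    omega

lemma oneLine_injective {N : ℕ} {π ρ : Equiv.Perm (Fin N)} (h : oneLine π = oneLine ρ) :
    π = ρ := by
  ext i
  have hi := congrFun h (i + 1)
  have h1 : 1 ≤ (i : ℕ) + 1 ∧ (i : ℕ) + 1 ≤ N := ⟨by omega, i.2⟩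
  simpa [oneLine, h1] using hi

lemma IsWord.exists_perm {N : ℕ} {w : ℕ → ℕ} (hw : IsWord N w) :
    ∃ π : Equiv.Perm (Fin N), oneLine π = w := by
  have hlt : ∀ i : Fin N, w (i + 1) - 1 < N := fun i => by
    have := hw.le (i + 1) (by omega) i.2
    have := hw.pos (i + 1) (by omega) i.2
    omega
  have hinj : Function.Injective (fun i : Fin N => (⟨w (i + 1) - 1, hlt i⟩ : Fin N)) := by
    intro i j h
    simp only [Fin.mk.injEq] at h
    have := hw.pos (i + 1) (by omega) i.2
    have := hw.pos (j + 1) (by omega) j.2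
    have := hw.inj (i + 1) (j + 1) (by omega) i.2 (by omega) j.2 (by omega)
    exact Fin.ext (by omega)
  refine ⟨Equiv.ofBijective _ (Finite.injective_iff_bijective.1 hinj), ?_⟩
  funext i
  by_cases hi : 1 ≤ i ∧ i ≤ N
  · simp only [oneLine, hi, and_self, dite_true, Equiv.ofBijective_apply]
    have := hw.pos i hi.1 hi.2
    rw [Nat.sub_add_cancel hi.1]
    omega
  · rw [oneLine, dif_neg hi, hw.zero i (by omega)]

lemma mem_Excp {g ℓ N : ℕ} {w : ℕ → ℕ} {i : ℕ} :
    i ∈ Excp g ℓ N w ↔ (1 ≤ i ∧ i ≤ N) ∧ i + g ≤ w i ∧ ℓ ≤ w i := by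
  simp [Excp]

lemma mem_Nexcp {g ℓ N : ℕ} {w : ℕ → ℕ} {i : ℕ} :
    i ∈ Nexcp g ℓ N w ↔ (1 ≤ i ∧ i ≤ N) ∧ i ∉ Excp g ℓ N w := by
  simp [Nexcp]

lemma mem_Excl {g ℓ N : ℕ} {w : ℕ → ℕ} {e : ℕ} :
    e ∈ Excl g ℓ N w ↔ ∃ i ∈ Excp g ℓ N w, w i = e := by
  simp [Excl]

lemma IsWord.mem_Excl_apply {g ℓ N : ℕ} {w : ℕ → ℕ} (hw : IsWord N w) {i : ℕ} (h1 : 1 ≤ i)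
    (h2 : i ≤ N) : w i ∈ Excl g ℓ N w ↔ i ∈ Excp g ℓ N w := by
  rw [mem_Excl]
  constructor
  · rintro ⟨j, hj, hji⟩
    have := mem_Excp.1 hj
    rwa [← hw.inj j i this.1.1 this.1.2 h1 h2 hji]
  · exact fun h => ⟨i, h, rfl⟩

lemma IsWord.bounds_of_mem_Excl {g ℓ N : ℕ} {w : ℕ → ℕ} (hw : IsWord N w) {e : ℕ}
    (he : e ∈ Excl g ℓ N w) : 1 ≤ e ∧ e ≤ N ∧ ℓ ≤ e := by
  obtain ⟨i, hi, rfl⟩ := mem_Excl.1 he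
  have := mem_Excp.1 hi
  exact ⟨hw.pos i this.1.1 this.1.2, hw.le i this.1.1 this.1.2, this.2.2⟩

lemma IsWord.surj {N : ℕ} {w : ℕ → ℕ} (hw : IsWord N w) {z : ℕ} (h1 : 1 ≤ z) (h2 : z ≤ N) :
    ∃ i, 1 ≤ i ∧ i ≤ N ∧ w i = z := by
  have him : (Icc 1 N).image w = Icc 1 N := by
    apply eq_of_subset_of_card_le
    · intro y hy
      obtain ⟨i, hi, rfl⟩ := mem_image.1 hy
      rw [mem_Icc] at hi ⊢
      exact ⟨hw.pos i hi.1 hi.2, hw.le i hi.1 hi.2⟩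
    · rw [card_image_of_injOn]
      intro i hi j hj h
      simp only [coe_Icc, Set.mem_Icc] at hi hj
      exact hw.inj i j hi.1 hi.2 hj.1 hj.2 h
  have : z ∈ (Icc 1 N).image w := by rw [him, mem_Icc]; exact ⟨h1, h2⟩
  obtain ⟨i, hi, rfl⟩ := mem_image.1 this
  rw [mem_Icc] at hi
  exact ⟨i, hi.1, hi.2, rfl⟩

lemma IsWord.card_Excl {g ℓ N : ℕ} {w : ℕ → ℕ} (hw : IsWord N w) :
    (Excl g ℓ N w).card = (Excp g ℓ N w).card := by
  rw [Excl, card_image_of_injOn]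
  intro i hi j hj h
  have hi := (mem_Excp.1 hi).1
  have hj := (mem_Excp.1 hj).1
  exact hw.inj i j hi.1 hi.2 hj.1 hj.2 h

/-! ### Inversions -/

/-- Inversions depend only on the relative order of places and of letters, so they survive when P
keeps the first and the passage from w to θ keeps the second. -/
lemma invOn_image {w θ P : ℕ → ℕ} {S : Finset ℕ} (hP : ∀ i ∈ S, ∀ j ∈ S, i < j → P i < P j)
    (h : ∀ i ∈ S, ∀ j ∈ S, θ (P i) < θ (P j) ↔ w i < w j) :
    invOn θ (S.image P) = invOn w S := by
  have hlt : ∀ i ∈ S, ∀ j ∈ S, (P i < P j ↔ i < j) := fun i hi j hj => by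
    refine ⟨fun hij => ?_, hP i hi j hj⟩
    by_contra hc
    rcases (not_lt.1 hc).eq_or_lt with rfl | hc
    · exact lt_irrefl _ hij
    · exact lt_asymm hij (hP j hj i hi hc)
  symm
  unfold invOn
  refine card_bij (fun p _ => (P p.1, P p.2)) ?_ ?_ ?_
  · rintro ⟨i, j⟩ hp
    simp only [mem_filter, mem_product] at hp ⊢
    exact ⟨⟨mem_image_of_mem _ hp.1.1, mem_image_of_mem _ hp.1.2⟩,
      hP _ hp.1.1 _ hp.1.2 hp.2.1, (h _ hp.1.2 _ hp.1.1).2 hp.2.2⟩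
  · rintro ⟨i, j⟩ hp ⟨i', j'⟩ hp' heq
    simp only [mem_filter, mem_product, Prod.mk.injEq] at hp hp' heq ⊢
    have inj : ∀ i ∈ S, ∀ j ∈ S, P i = P j → i = j := fun i hi j hj hij => by
      have h1 := hlt i hi j hj
      have h2 := hlt j hj i hi
      omega
    exact ⟨inj _ hp.1.1 _ hp'.1.1 heq.1, inj _ hp.1.2 _ hp'.1.2 heq.2⟩
  · rintro ⟨p, q⟩ hp
    simp only [mem_filter, mem_product, mem_image] at hp
    obtain ⟨⟨⟨i, hi, rfl⟩, ⟨j, hj, rfl⟩⟩, h1, h2⟩ := hp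
    refine ⟨(i, j), ?_, rfl⟩
    simp only [mem_filter, mem_product]
    exact ⟨⟨hi, hj⟩, (hlt i hi j hj).1 h1, (h j hj i hi).1 h2⟩

lemma invOn_congr {v w : ℕ → ℕ} {S : Finset ℕ} (h : ∀ i ∈ S, v i = w i) :
    invOn v S = invOn w S := by
  unfold invOn
  congr 1
  refine filter_congr fun p hp => ?_
  rw [mem_product] at hp
  rw [h _ hp.1, h _ hp.2]

lemma invOn_eq_sum (w : ℕ → ℕ) (S : Finset ℕ) :
    invOn w S = ∑ j ∈ S, ({i ∈ S | i < j ∧ w j < w i} : Finset ℕ).card := by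
  unfold invOn
  rw [card_filter, sum_product_right]
  refine sum_congr rfl fun j _ => ?_
  rw [card_filter]

lemma invOn_insert {w : ℕ → ℕ} {S : Finset ℕ} {x : ℕ} (hx : x ∉ S) :
    invOn w (insert x S) = invOn w S + ({i ∈ S | i < x ∧ w x < w i} : Finset ℕ).card +
      ({i ∈ S | x < i ∧ w i < w x} : Finset ℕ).card := by
  rw [invOn_eq_sum, invOn_eq_sum, sum_insert hx, filter_insert, if_neg (by simp)]
  have : ∀ j ∈ S, ({i ∈ insert x S | i < j ∧ w j < w i} : Finset ℕ).card =
      ({i ∈ S | i < j ∧ w j < w i} : Finset ℕ).card + if x < j ∧ w j < w x then 1 else 0 := by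
    intro j _
    rw [filter_insert]
    split_ifs with h
    · rw [card_insert_of_notMem (by simp [hx])]
    · rfl
  rw [sum_congr rfl this, sum_add_distrib, ← card_filter]
  ring

/-- Permuting the letters on an initial set of places does not change the inversions that
involve a later place. -/
lemma invOn_union_add {v θ : ℕ → ℕ} {S U : Finset ℕ} (hSU : ∀ i ∈ S, ∀ j ∈ U, i < j)
    (hU : ∀ j ∈ U, θ j = v j) (hS : S.image θ = S.image v)
    (hv : Set.InjOn v S) (hθ : Set.InjOn θ S) :
    invOn θ (S ∪ U) + invOn v S = invOn v (S ∪ U) + invOn θ S := by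
  have hdisj : Disjoint S U := by
    rw [disjoint_left]
    exact fun i hi hi' => lt_irrefl _ (hSU i hi i hi')
  -- Inversions split into those inside S, those inside U, and those across; the last count sees S
  -- only through its set of letters.
  have key : ∀ u : ℕ → ℕ, Set.InjOn u S → invOn u (S ∪ U) = invOn u S + invOn u U +
      ∑ j ∈ U, ({e ∈ S.image u | u j < e} : Finset ℕ).card := by
    intro u hu
    rw [invOn_eq_sum, invOn_eq_sum, invOn_eq_sum, sum_union hdisj, add_assoc, ← sum_add_distrib]
    congr 1
    · refine sum_congr rfl fun j hj => ?_
      rw [filter_union, card_union_of_disjoint (disjoint_filter_filter hdisj)]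
      have : ({i ∈ U | i < j ∧ u j < u i} : Finset ℕ) = ∅ :=
        filter_eq_empty_iff.2 fun i hi h => lt_asymm h.1 (hSU j hj i hi)
      rw [this, card_empty, add_zero]
    · refine sum_congr rfl fun j hj => ?_
      rw [filter_union, card_union_of_disjoint (disjoint_filter_filter hdisj), add_comm]
      congr 1
      rw [filter_image, card_image_of_injOn (hu.mono fun i hi => (mem_filter.1 hi).1)]
      congr 1
      exact filter_congr fun i hi => by simp [hSU i hi j hj]
  have hsum : ∑ j ∈ U, ({e ∈ S.image θ | θ j < e} : Finset ℕ).card =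
      ∑ j ∈ U, ({e ∈ S.image v | v j < e} : Finset ℕ).card :=
    sum_congr rfl fun j hj => by rw [hS, hU j hj]
  rw [key θ hθ, key v hv, hsum, invOn_congr hU]
  ring

/-! ### The next element of a set -/

lemma untopD_min_mem (S : Finset ℕ) (n : ℕ) : S.min.untopD n ∈ insert n S := by
  rcases S.eq_empty_or_nonempty with rfl | h
  · simp
  · obtain ⟨m, hm⟩ := min_of_nonempty h
    rw [hm]
    exact mem_insert_of_mem (mem_of_min hm)

lemma untopD_min_le {S : Finset ℕ} (n : ℕ) {t : ℕ} (ht : t ∈ S) : S.min.untopD n ≤ t := by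
  obtain ⟨m, hm⟩ := min_of_mem ht
  rw [hm]
  exact min_le_of_eq ht hm

lemma unbotD_max_mem {S : Finset ℕ} (h : S.Nonempty) (n : ℕ) : S.max.unbotD n ∈ S := by
  obtain ⟨m, hm⟩ := max_of_nonempty h
  rw [hm]
  exact mem_of_max hm

lemma le_unbotD_max {S : Finset ℕ} (n : ℕ) {t : ℕ} (ht : t ∈ S) : t ≤ S.max.unbotD n := by
  obtain ⟨m, hm⟩ := max_of_mem ht
  rw [hm]
  exact le_max_of_eq ht hm

/-- The smallest element of `T` above `z`, and `n` if there is none. -/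
def nextIn (T : Finset ℕ) (n z : ℕ) : ℕ := ({t ∈ T | z < t}).min.untopD n

lemma nextIn_mem (T : Finset ℕ) (n z : ℕ) : nextIn T n z ∈ insert n T := by
  have := untopD_min_mem ({t ∈ T | z < t}) n
  rw [mem_insert, mem_filter] at this
  rw [mem_insert]
  exact this.imp id And.left

lemma lt_nextIn (T : Finset ℕ) {n z : ℕ} (hz : z < n) : z < nextIn T n z := by
  have := untopD_min_mem ({t ∈ T | z < t}) n
  rw [mem_insert, mem_filter] at this
  rcases this with h | h
  · rw [nextIn, h]; exact hz
  · exact h.2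

lemma nextIn_le {T : Finset ℕ} (n : ℕ) {z t : ℕ} (ht : t ∈ T) (hz : z < t) :
    nextIn T n z ≤ t :=
  untopD_min_le n (mem_filter.2 ⟨ht, hz⟩)

lemma nextIn_eq {T : Finset ℕ} {n z j : ℕ} (hT : ∀ t ∈ T, t < n) (hj : j ∈ insert n T)
    (hz : z < j) (h : ∀ t ∈ T, z < t → j ≤ t) : nextIn T n z = j := by
  have hjn : j ≤ n := by
    rcases mem_insert.1 hj with rfl | hj
    · exact le_rfl
    · exact (hT j hj).le
  apply le_antisymm
  · rcases mem_insert.1 hj with rfl | hj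
    · rcases mem_insert.1 (nextIn_mem T j z) with h' | h'
      · exact h'.le
      · exact (hT _ h').le
    · exact nextIn_le n hj hz
  · rcases mem_insert.1 (nextIn_mem T n z) with h' | h'
    · rw [h']; exact hjn
    · exact h _ h' (lt_nextIn T (by omega))

/-- With `t₁ < ⋯ < t_s` the elements of `T` and `t_{s+1} = n`, the map that sends every
`t_j ≥ a` to `t_{j+1}` and fixes the other numbers. -/
def bump (T : Finset ℕ) (n a z : ℕ) : ℕ := if z ∈ T ∧ a ≤ z then nextIn T n z else z

lemma bump_of_notMem {T : Finset ℕ} {n a z : ℕ} (hz : z ∉ T) : bump T n a z = z := by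
  simp [bump, hz]

lemma bump_of_lt {T : Finset ℕ} {n a z : ℕ} (hz : z < a) : bump T n a z = z := by
  rw [bump, if_neg]
  omega

lemma bump_of_le {T : Finset ℕ} {n a z : ℕ} (hz : z ∈ T) (h : a ≤ z) :
    bump T n a z = nextIn T n z := by
  simp [bump, hz, h]

section Bump

variable {T : Finset ℕ} {n a z y : ℕ} (hT : ∀ t ∈ T, t < n)

include hT

lemma le_bump : z ≤ bump T n a z := by
  unfold bump
  split_ifs with h
  · exact (lt_nextIn T (hT z h.1)).le
  · exact le_rfl

lemma bump_lt_bump (hz : z ∈ T) (hy : y ∈ T) (h : z < y) : bump T n a z < bump T n a y := by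
  have h1 := le_bump (a := a) (z := y) hT
  rcases lt_or_ge z a with hza | hza
  · rw [bump_of_lt hza]; omega
  · rw [bump_of_le hz hza, bump_of_le hy (by omega)]
    have := nextIn_le n hy h
    have := lt_nextIn T (hT y hy)
    omega

lemma bump_lt_bump_iff (hz : z ∈ T) (hy : y ∈ T) :
    bump T n a z < bump T n a y ↔ z < y := by
  refine ⟨fun h => ?_, bump_lt_bump hT hz hy⟩
  by_contra hc
  rcases (not_lt.1 hc).eq_or_lt with rfl | hc
  · exact lt_irrefl _ h
  · exact lt_asymm h (bump_lt_bump hT hy hz hc)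

omit hT in
lemma bump_mem (hz : z ∈ T) : bump T n a z ∈ insert n T := by
  unfold bump
  split_ifs with h
  · exact nextIn_mem T n z
  · exact mem_insert_of_mem hz

lemma bump_ne_of_mem (hz : z ∈ T) : bump T n a z ≠ a := by
  rcases lt_or_ge z a with hza | hza
  · rw [bump_of_lt hza]; omega
  · rw [bump_of_le hz hza]
    have := lt_nextIn T (hT z hz)
    omega

lemma bump_ne (ha : a ∈ insert n T) (hz : z < n) : bump T n a z ≠ a := by
  by_cases h : z ∈ T
  · exact bump_ne_of_mem hT h
  · rw [bump_of_notMem h]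
    rintro rfl
    rw [mem_insert] at ha
    rcases ha with ha | ha
    · omega
    · exact h ha

lemma bump_le (hz : z < n) : bump T n a z ≤ n := by
  by_cases h : z ∈ T
  · rcases mem_insert.1 (bump_mem (n := n) (a := a) h) with h | h
    · exact h.le
    · exact (hT _ h).le
  · rw [bump_of_notMem h]
    exact hz.le

/-- Each element from a on moves to its successor and the last one to n, so exactly the slot a
becomes free. This serves both for places and for letters. -/
lemma image_bump (ha : a ∈ insert n T) : T.image (bump T n a) = (insert n T).erase a := by
  apply eq_of_subset_of_card_le
  · intro y hy
    obtain ⟨z, hz, rfl⟩ := mem_image.1 hy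
    exact mem_erase.2 ⟨bump_ne_of_mem hT hz, bump_mem hz⟩
  · rw [card_image_of_injOn, card_erase_of_mem ha, card_insert_of_notMem]
    · rfl
    · exact fun h => lt_irrefl _ (hT n h)
    · intro z hz y hy h
      have h1 := bump_lt_bump_iff (a := a) hT hz hy
      have h2 := bump_lt_bump_iff (a := a) hT hy hz
      omega

lemma bump_inj (hz : z < n) (hy : y < n) (h : bump T n a z = bump T n a y) : z = y := by
  have aux : ∀ z y, z < n → y < n → z ∈ T → y ∉ T → bump T n a z ≠ bump T n a y := by
    intro z y _ hyn hz hy heq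
    have := bump_mem (n := n) (a := a) hz
    rw [heq, bump_of_notMem hy, mem_insert] at this
    rcases this with h | h
    · omega
    · exact hy h
  by_cases hzT : z ∈ T <;> by_cases hyT : y ∈ T
  · have h1 := bump_lt_bump_iff (a := a) hT hzT hyT
    have h2 := bump_lt_bump_iff (a := a) hT hyT hzT
    omega
  · exact absurd h (aux z y hz hy hzT hyT)
  · exact absurd h.symm (aux y z hy hz hyT hzT)
  · rwa [bump_of_notMem hzT, bump_of_notMem hyT] at h

lemma exists_bump_eq (ha : a ∈ insert n T) (hy : y ≤ n) (hya : y ≠ a) :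
    ∃ z < n, bump T n a z = y := by
  by_cases h : y ∈ insert n T
  · have : y ∈ T.image (bump T n a) := by
      rw [image_bump hT ha]; exact mem_erase.2 ⟨hya, h⟩
    obtain ⟨z, hz, rfl⟩ := mem_image.1 this
    exact ⟨z, hT z hz, rfl⟩
  · rw [mem_insert, not_or] at h
    exact ⟨y, by omega, bump_of_notMem h.2⟩

end Bump

/-- The word `θ` arises from the word `w` of length `N` by making room for a place `x` (bumping
the places in `T`) and for a letter `a` (bumping the excedance letters), and by putting the letter
`a` at the place `x`. -/
structure IsInsertion (g ℓ N : ℕ) (w : ℕ → ℕ) (T : Finset ℕ) (x a : ℕ) (θ : ℕ → ℕ) : Prop where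
  gap_pos : 1 ≤ g
  level_pos : 1 ≤ ℓ
  le_succ : g + ℓ ≤ N + 1
  word : IsWord N w
  bounds : ∀ i ∈ T, 1 ≤ i ∧ i ≤ N
  mem_of_le : ∀ i, ℓ ≤ i → i ≤ N → i ∈ T
  place_mem : x ∈ insert (N + 1) T
  letter_mem : a ∈ insert (N + 1) (Excl g (g + ℓ) N w)
  -- An excedance that is pushed one step to the right also has its letter raised, and so remains an
  -- excedance.
  letter_le : ∀ i ∈ Excp g (g + ℓ) N w, ℓ ≤ i → x ≤ i → a ≤ w i
  -- Within each class, the low places either all move along T or all stay fixed. This keeps their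
  -- order, hence their inversions.
  excp : (∀ i ∈ Excp g (g + ℓ) N w, i ∈ T) ∨ ∀ i ∈ Excp g (g + ℓ) N w, i < ℓ → i ∉ T
  nexcp : (∀ i ∈ Nexcp g (g + ℓ) N w, i ∈ T) ∨ ∀ i ∈ Nexcp g (g + ℓ) N w, i < ℓ → i ∉ T
  apply_place : θ x = a
  apply_bump : ∀ i, 1 ≤ i → i ≤ N →
    θ (bump T (N + 1) x i) = bump (Excl g (g + ℓ) N w) (N + 1) a (w i)
  zero : ∀ i, i = 0 ∨ N + 1 < i → θ i = 0

/-! ### Excedances, inversions and the Denert statistic after an insertion -/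

namespace IsInsertion

variable {g ℓ N x a : ℕ} {w θ : ℕ → ℕ} {T : Finset ℕ}

lemma place_lt (h : IsInsertion g ℓ N w T x a θ) : ∀ i ∈ T, i < N + 1 :=
  fun i hi => Nat.lt_succ_of_le (h.bounds i hi).2

lemma letter_lt (h : IsInsertion g ℓ N w T x a θ) : ∀ e ∈ Excl g (g + ℓ) N w, e < N + 1 :=
  fun _ he => Nat.lt_succ_of_le (h.word.bounds_of_mem_Excl he).2.1

lemma place_bounds (h : IsInsertion g ℓ N w T x a θ) : 1 ≤ x ∧ x ≤ N + 1 := by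
  rcases mem_insert.1 h.place_mem with rfl | hx
  · omega
  · have := h.bounds x hx; omega

lemma letter_bounds (h : IsInsertion g ℓ N w T x a θ) : g + ℓ ≤ a ∧ a ≤ N + 1 := by
  rcases mem_insert.1 h.letter_mem with rfl | ha
  · exact ⟨h.le_succ, le_rfl⟩
  · have := h.word.bounds_of_mem_Excl ha; omega

lemma bump_bounds (h : IsInsertion g ℓ N w T x a θ) {i : ℕ} (h1 : 1 ≤ i) (h2 : i ≤ N) :
    1 ≤ bump T (N + 1) x i ∧ bump T (N + 1) x i ≤ N + 1 ∧ bump T (N + 1) x i ≠ x :=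
  ⟨h1.trans (le_bump h.place_lt), bump_le h.place_lt (by omega),
    bump_ne h.place_lt h.place_mem (by omega)⟩

lemma exists_place (h : IsInsertion g ℓ N w T x a θ) {p : ℕ} (h1 : 1 ≤ p) (h2 : p ≤ N + 1)
    (hp : p ≠ x) : ∃ i, (1 ≤ i ∧ i ≤ N) ∧ bump T (N + 1) x i = p := by
  obtain ⟨i, hi, rfl⟩ := exists_bump_eq h.place_lt h.place_mem h2 hp
  refine ⟨i, ⟨?_, by omega⟩, rfl⟩
  by_contra hc
  have hT : i ∉ T := fun hiT => hc (h.bounds i hiT).1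
  rw [bump_of_notMem hT] at h1
  exact hc h1

lemma le_bump_letter (h : IsInsertion g ℓ N w T x a θ) (z : ℕ) :
    z ≤ bump (Excl g (g + ℓ) N w) (N + 1) a z := le_bump h.letter_lt

lemma isWord (h : IsInsertion g ℓ N w T x a θ) : IsWord (N + 1) θ := by
  have hne : ∀ i, 1 ≤ i → i ≤ N → bump (Excl g (g + ℓ) N w) (N + 1) a (w i) ≠ a :=
    fun i h1 h2 => bump_ne h.letter_lt h.letter_mem (Nat.lt_succ_of_le (h.word.le i h1 h2))
  refine ⟨fun p h1 h2 => ?_, fun p h1 h2 => ?_, fun p q h1 h2 h3 h4 hpq => ?_, h.zero⟩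
  · rcases eq_or_ne p x with rfl | hp
    · rw [h.apply_place]; have := h.letter_bounds; have := h.gap_pos; omega
    · obtain ⟨i, hi, rfl⟩ := h.exists_place h1 h2 hp
      rw [h.apply_bump i hi.1 hi.2]
      exact (h.word.pos i hi.1 hi.2).trans (h.le_bump_letter _)
  · rcases eq_or_ne p x with rfl | hp
    · rw [h.apply_place]; exact h.letter_bounds.2
    · obtain ⟨i, hi, rfl⟩ := h.exists_place h1 h2 hp
      rw [h.apply_bump i hi.1 hi.2]
      exact bump_le h.letter_lt (Nat.lt_succ_of_le (h.word.le i hi.1 hi.2))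
  · by_cases hp : p = x <;> by_cases hq : q = x
    · rw [hp, hq]
    · obtain ⟨i, hi, rfl⟩ := h.exists_place h3 h4 hq
      rw [hp, h.apply_place, h.apply_bump i hi.1 hi.2] at hpq
      exact absurd hpq.symm (hne i hi.1 hi.2)
    · obtain ⟨i, hi, rfl⟩ := h.exists_place h1 h2 hp
      rw [hq, h.apply_place, h.apply_bump i hi.1 hi.2] at hpq
      exact absurd hpq (hne i hi.1 hi.2)
    · obtain ⟨i, hi, rfl⟩ := h.exists_place h1 h2 hp
      obtain ⟨j, hj, rfl⟩ := h.exists_place h3 h4 hq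
      rw [h.apply_bump i hi.1 hi.2, h.apply_bump j hj.1 hj.2] at hpq
      have := bump_inj h.letter_lt (Nat.lt_succ_of_le (h.word.le i hi.1 hi.2))
        (Nat.lt_succ_of_le (h.word.le j hj.1 hj.2)) hpq
      rw [h.word.inj i j hi.1 hi.2 hj.1 hj.2 this]

/-- With equal excedance letters the two words undergo the same bump of letters, which is injective.
-/
lemma word_unique {w' : ℕ → ℕ} (h : IsInsertion g ℓ N w T x a θ)
    (h' : IsInsertion g ℓ N w' T x a θ) (hE : Excl g (g + ℓ) N w = Excl g (g + ℓ) N w') :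
    w = w' := by
  funext i
  by_cases hi : 1 ≤ i ∧ i ≤ N
  · have h1 := h.apply_bump i hi.1 hi.2
    rw [h'.apply_bump i hi.1 hi.2, ← hE] at h1
    exact (bump_inj h.letter_lt (Nat.lt_succ_of_le (h'.word.le i hi.1 hi.2))
      (Nat.lt_succ_of_le (h.word.le i hi.1 hi.2)) h1).symm
  · rw [h.word.zero i (by omega), h'.word.zero i (by omega)]

lemma bump_of_level_le (h : IsInsertion g ℓ N w T x a θ) {i : ℕ} (hi : ℓ ≤ i) (hN : i ≤ N) :
    bump T (N + 1) x i = if x ≤ i then i + 1 else i := by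
  split_ifs with hx
  · rw [bump_of_le (h.mem_of_le i hi hN) hx]
    refine nextIn_eq h.place_lt ?_ (by omega) fun t _ ht => ht
    rw [mem_insert]
    rcases hN.eq_or_lt with rfl | hN
    · exact Or.inl rfl
    · exact Or.inr (h.mem_of_le _ (by omega) hN)
  · exact bump_of_lt (by omega)

/-- Since g ≥ 1, the place ℓ is at most N and so lies in T: no low place can jump over it. -/
lemma bump_le_level (h : IsInsertion g ℓ N w T x a θ) {i : ℕ} (hi : i < ℓ) :
    bump T (N + 1) x i ≤ ℓ := by
  unfold bump
  split_ifs with hx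
  · have h1 := h.le_succ
    have h2 := h.gap_pos
    exact nextIn_le _ (h.mem_of_le ℓ le_rfl (by omega)) hi
  · exact hi.le

lemma apply_bump_of_excp (h : IsInsertion g ℓ N w T x a θ) {i : ℕ}
    (hi : i ∈ Excp g (g + ℓ) N w) : bump T (N + 1) x i + g ≤ θ (bump T (N + 1) x i) ∧
      g + ℓ ≤ θ (bump T (N + 1) x i) := by
  have hi' := mem_Excp.1 hi
  have h1 := h.le_bump_letter (w i)
  rw [h.apply_bump i hi'.1.1 hi'.1.2]
  refine ⟨?_, by omega⟩
  -- A low place lands at ℓ at most, and the level g + ℓ of the letter leaves the required gap. From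
  -- ℓ on, a shift by one is compensated by the raised letter.
  rcases lt_or_ge i ℓ with hil | hil
  · have := h.bump_le_level hil
    omega
  · rw [h.bump_of_level_le hil hi'.1.2]
    split_ifs with hx
    · have hE : w i ∈ Excl g (g + ℓ) N w := (h.word.mem_Excl_apply hi'.1.1 hi'.1.2).2 hi
      rw [bump_of_le hE (h.letter_le i hi hil hx)]
      have := lt_nextIn (Excl g (g + ℓ) N w) (h.letter_lt _ hE)
      omega
    · omega

lemma apply_bump_of_nexcp (h : IsInsertion g ℓ N w T x a θ) {i : ℕ}
    (hi : i ∈ Nexcp g (g + ℓ) N w) : θ (bump T (N + 1) x i) = w i := by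
  rw [mem_Nexcp] at hi
  rw [h.apply_bump i hi.1.1 hi.1.2, bump_of_notMem]
  rw [h.word.mem_Excl_apply hi.1.1 hi.1.2]
  exact hi.2

lemma bump_mem_Excp (h : IsInsertion g ℓ N w T x a θ) {i : ℕ} (h1 : 1 ≤ i) (h2 : i ≤ N) :
    bump T (N + 1) x i ∈ Excp g (g + ℓ) (N + 1) θ ↔ i ∈ Excp g (g + ℓ) N w := by
  have hb := h.bump_bounds h1 h2
  constructor
  · intro hP
    by_contra hi
    rw [mem_Excp, h.apply_bump_of_nexcp (mem_Nexcp.2 ⟨⟨h1, h2⟩, hi⟩)] at hP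
    have : i ≤ bump T (N + 1) x i := le_bump h.place_lt
    exact hi (mem_Excp.2 ⟨⟨h1, h2⟩, by omega, hP.2.2⟩)
  · intro hi
    exact mem_Excp.2 ⟨⟨hb.1, hb.2.1⟩, h.apply_bump_of_excp hi⟩

lemma place_mem_Excp (h : IsInsertion g ℓ N w T x a θ) :
    x ∈ Excp g (g + ℓ) (N + 1) θ ↔ x + g ≤ a := by
  have := h.place_bounds
  have := h.letter_bounds
  rw [mem_Excp, h.apply_place]
  omega

lemma Excp_eq_of_le (h : IsInsertion g ℓ N w T x a θ) (hx : x + g ≤ a) :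
    Excp g (g + ℓ) (N + 1) θ = insert x ((Excp g (g + ℓ) N w).image (bump T (N + 1) x)) := by
  ext p
  rw [mem_insert, mem_image]
  constructor
  · intro hp
    by_cases hpx : p = x
    · exact Or.inl hpx
    · obtain ⟨i, hi, rfl⟩ := h.exists_place (mem_Excp.1 hp).1.1 (mem_Excp.1 hp).1.2 hpx
      exact Or.inr ⟨i, (h.bump_mem_Excp hi.1 hi.2).1 hp, rfl⟩
  · rintro (rfl | ⟨i, hi, rfl⟩)
    · exact h.place_mem_Excp.2 hx
    · exact (h.bump_mem_Excp (mem_Excp.1 hi).1.1 (mem_Excp.1 hi).1.2).2 hi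

lemma Nexcp_eq_of_le (h : IsInsertion g ℓ N w T x a θ) (hx : x + g ≤ a) :
    Nexcp g (g + ℓ) (N + 1) θ = (Nexcp g (g + ℓ) N w).image (bump T (N + 1) x) := by
  ext p
  rw [mem_Nexcp, mem_image]
  constructor
  · rintro ⟨hp, hpX⟩
    have hpx : p ≠ x := fun hpx => hpX (hpx ▸ h.place_mem_Excp.2 hx)
    obtain ⟨i, hi, rfl⟩ := h.exists_place hp.1 hp.2 hpx
    rw [h.bump_mem_Excp hi.1 hi.2] at hpX
    exact ⟨i, mem_Nexcp.2 ⟨hi, hpX⟩, rfl⟩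
  · rintro ⟨i, hi, rfl⟩
    rw [mem_Nexcp] at hi
    have := h.bump_bounds hi.1.1 hi.1.2
    rw [h.bump_mem_Excp hi.1.1 hi.1.2]
    exact ⟨⟨this.1, this.2.1⟩, hi.2⟩

lemma Excp_eq_of_lt (h : IsInsertion g ℓ N w T x a θ) (hx : a < x + g) :
    Excp g (g + ℓ) (N + 1) θ = (Excp g (g + ℓ) N w).image (bump T (N + 1) x) := by
  ext p
  rw [mem_image]
  constructor
  · intro hp
    have hpx : p ≠ x := fun hpx => by
      have := h.place_mem_Excp.1 (hpx ▸ hp)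
      omega
    obtain ⟨i, hi, rfl⟩ := h.exists_place (mem_Excp.1 hp).1.1 (mem_Excp.1 hp).1.2 hpx
    exact ⟨i, (h.bump_mem_Excp hi.1 hi.2).1 hp, rfl⟩
  · rintro ⟨i, hi, rfl⟩
    exact (h.bump_mem_Excp (mem_Excp.1 hi).1.1 (mem_Excp.1 hi).1.2).2 hi

lemma Nexcp_eq_of_lt (h : IsInsertion g ℓ N w T x a θ) (hx : a < x + g) :
    Nexcp g (g + ℓ) (N + 1) θ = insert x ((Nexcp g (g + ℓ) N w).image (bump T (N + 1) x)) := by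
  ext p
  rw [mem_Nexcp, mem_insert, mem_image]
  constructor
  · rintro ⟨hp, hpX⟩
    by_cases hpx : p = x
    · exact Or.inl hpx
    · obtain ⟨i, hi, rfl⟩ := h.exists_place hp.1 hp.2 hpx
      rw [h.bump_mem_Excp hi.1 hi.2] at hpX
      exact Or.inr ⟨i, mem_Nexcp.2 ⟨hi, hpX⟩, rfl⟩
  · rintro (rfl | ⟨i, hi, rfl⟩)
    · refine ⟨h.place_bounds, ?_⟩
      rw [h.place_mem_Excp]
      omega
    · rw [mem_Nexcp] at hi
      have := h.bump_bounds hi.1.1 hi.1.2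
      rw [h.bump_mem_Excp hi.1.1 hi.1.2]
      exact ⟨⟨this.1, this.2.1⟩, hi.2⟩

lemma image_apply_bump (h : IsInsertion g ℓ N w T x a θ) :
    ((Excp g (g + ℓ) N w).image (bump T (N + 1) x)).image θ =
      (insert (N + 1) (Excl g (g + ℓ) N w)).erase a := by
  rw [← image_bump h.letter_lt h.letter_mem, image_image, Excl, image_image]
  refine image_congr fun i hi => ?_
  have := (mem_Excp.1 hi).1
  exact h.apply_bump i this.1 this.2

lemma Excl_eq_of_le (h : IsInsertion g ℓ N w T x a θ) (hx : x + g ≤ a) :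
    Excl g (g + ℓ) (N + 1) θ = insert (N + 1) (Excl g (g + ℓ) N w) := by
  rw [Excl, h.Excp_eq_of_le hx, image_insert, h.image_apply_bump, h.apply_place,
    insert_erase h.letter_mem]

lemma Excl_eq_of_lt (h : IsInsertion g ℓ N w T x a θ) (hx : a < x + g) :
    Excl g (g + ℓ) (N + 1) θ = (insert (N + 1) (Excl g (g + ℓ) N w)).erase a := by
  rw [Excl, h.Excp_eq_of_lt hx, h.image_apply_bump]

lemma notMem_Excl (h : IsInsertion g ℓ N w T x a θ) : N + 1 ∉ Excl g (g + ℓ) N w :=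
  fun hc => lt_irrefl _ (h.letter_lt _ hc)

/-- The set of excedance letters is recovered from the inserted letter. -/
lemma Excl_eq (h : IsInsertion g ℓ N w T x a θ) :
    Excl g (g + ℓ) N w = (insert a (Excl g (g + ℓ) (N + 1) θ)).erase (N + 1) := by
  rcases lt_or_ge a (x + g) with hx | hx
  · rw [h.Excl_eq_of_lt hx, insert_erase h.letter_mem, erase_insert h.notMem_Excl]
  · rw [h.Excl_eq_of_le hx, insert_eq_of_mem h.letter_mem, erase_insert h.notMem_Excl]

lemma bump_lt_bump_of (h : IsInsertion g ℓ N w T x a θ) {S : Finset ℕ}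
    (hS : (∀ i ∈ S, i ∈ T) ∨ ∀ i ∈ S, i < ℓ → i ∉ T) (hN : ∀ i ∈ S, i ≤ N) :
    ∀ i ∈ S, ∀ j ∈ S, i < j → bump T (N + 1) x i < bump T (N + 1) x j := by
  intro i hi j hj hij
  by_cases hiT : i ∈ T
  · have hjT : j ∈ T := by
      rcases hS with hS | hS
      · exact hS j hj
      · refine h.mem_of_le j ?_ (hN j hj)
        by_contra hc
        exact hS i hi (by omega) hiT
    exact bump_lt_bump h.place_lt hiT hjT hij
  · rw [bump_of_notMem hiT]
    exact hij.trans_le (le_bump h.place_lt)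

lemma invOn_image_Excp (h : IsInsertion g ℓ N w T x a θ) :
    invOn θ ((Excp g (g + ℓ) N w).image (bump T (N + 1) x)) = invOn w (Excp g (g + ℓ) N w) := by
  refine invOn_image (h.bump_lt_bump_of h.excp fun i hi => (mem_Excp.1 hi).1.2) ?_
  intro i hi j hj
  have hi' := (mem_Excp.1 hi).1
  have hj' := (mem_Excp.1 hj).1
  rw [h.apply_bump i hi'.1 hi'.2, h.apply_bump j hj'.1 hj'.2]
  exact bump_lt_bump_iff h.letter_lt ((h.word.mem_Excl_apply hi'.1 hi'.2).2 hi)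
    ((h.word.mem_Excl_apply hj'.1 hj'.2).2 hj)

lemma invOn_image_Nexcp (h : IsInsertion g ℓ N w T x a θ) :
    invOn θ ((Nexcp g (g + ℓ) N w).image (bump T (N + 1) x)) =
      invOn w (Nexcp g (g + ℓ) N w) := by
  refine invOn_image (h.bump_lt_bump_of h.nexcp fun i hi => (mem_Nexcp.1 hi).1.2) ?_
  intro i hi j hj
  rw [h.apply_bump_of_nexcp hi, h.apply_bump_of_nexcp hj]

lemma notMem_image (h : IsInsertion g ℓ N w T x a θ) {S : Finset ℕ} (hN : ∀ i ∈ S, i ≤ N) :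
    x ∉ S.image (bump T (N + 1) x) := by
  rw [mem_image]
  rintro ⟨i, hi, hix⟩
  exact bump_ne h.place_lt h.place_mem (Nat.lt_succ_of_le (hN i hi)) hix

lemma sum_image_bump (h : IsInsertion g ℓ N w T x a θ) {S : Finset ℕ} (hN : ∀ i ∈ S, i ≤ N)
    (f : ℕ → ℕ) : ∑ p ∈ S.image (bump T (N + 1) x), f p = ∑ i ∈ S, f (bump T (N + 1) x i) :=
  sum_image fun i hi j hj hij => bump_inj h.place_lt (Nat.lt_succ_of_le (hN i hi))
    (Nat.lt_succ_of_le (hN j hj)) hij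

lemma card_filter_image_bump (h : IsInsertion g ℓ N w T x a θ) {S : Finset ℕ}
    (hN : ∀ i ∈ S, i ≤ N) (p : ℕ → Prop) [DecidablePred p] :
    ({i ∈ S.image (bump T (N + 1) x) | p i} : Finset ℕ).card =
      ({i ∈ S | p (bump T (N + 1) x i)} : Finset ℕ).card := by
  rw [card_filter, card_filter, h.sum_image_bump hN]

/-- The Denert statistic after the insertion of an excedance. -/
lemma den_of_le (h : IsInsertion g ℓ N w T x a θ) (hx : x + g ≤ a) :
    den g (g + ℓ) (N + 1) θ = (∑ i ∈ Excp g (g + ℓ) N w, (bump T (N + 1) x i + g - 1)) +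
      (x + g - 1) + invOn w (Excp g (g + ℓ) N w) + invOn w (Nexcp g (g + ℓ) N w) +
      ({i ∈ Excp g (g + ℓ) N w | bump T (N + 1) x i < x ∧ a < θ (bump T (N + 1) x i)} :
        Finset ℕ).card +
      ({i ∈ Excp g (g + ℓ) N w | x < bump T (N + 1) x i ∧ θ (bump T (N + 1) x i) < a} :
        Finset ℕ).card := by
  have hN : ∀ i ∈ Excp g (g + ℓ) N w, i ≤ N := fun i hi => (mem_Excp.1 hi).1.2
  rw [den, h.Excp_eq_of_le hx, h.Nexcp_eq_of_le hx, invOn_insert (h.notMem_image hN),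
    sum_insert (h.notMem_image hN), h.sum_image_bump hN, h.card_filter_image_bump hN,
    h.card_filter_image_bump hN, h.invOn_image_Excp, h.invOn_image_Nexcp, h.apply_place]
  ring

/-- The Denert statistic after the insertion of a letter that is no excedance. -/
lemma den_of_lt (h : IsInsertion g ℓ N w T x a θ) (hx : a < x + g) :
    den g (g + ℓ) (N + 1) θ = (∑ i ∈ Excp g (g + ℓ) N w, (bump T (N + 1) x i + g - 1)) +
      invOn w (Excp g (g + ℓ) N w) + invOn w (Nexcp g (g + ℓ) N w) +
      ({i ∈ Nexcp g (g + ℓ) N w | bump T (N + 1) x i < x ∧ a < w i} : Finset ℕ).card +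
      ({i ∈ Nexcp g (g + ℓ) N w | x < bump T (N + 1) x i ∧ w i < a} : Finset ℕ).card := by
  have hN : ∀ i ∈ Nexcp g (g + ℓ) N w, i ≤ N := fun i hi => (mem_Nexcp.1 hi).1.2
  have hN' : ∀ i ∈ Excp g (g + ℓ) N w, i ≤ N := fun i hi => (mem_Excp.1 hi).1.2
  have key : ∀ q : ℕ → ℕ → Prop, ∀ [∀ i j, Decidable (q i j)],
      ({i ∈ Nexcp g (g + ℓ) N w | q (bump T (N + 1) x i) (θ (bump T (N + 1) x i))} :
        Finset ℕ).card =
      ({i ∈ Nexcp g (g + ℓ) N w | q (bump T (N + 1) x i) (w i)} : Finset ℕ).card := by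
    intro q _
    congr 1
    exact filter_congr fun i hi => by rw [h.apply_bump_of_nexcp hi]
  rw [den, h.Excp_eq_of_lt hx, h.Nexcp_eq_of_lt hx, invOn_insert (h.notMem_image hN),
    h.sum_image_bump hN', h.card_filter_image_bump hN,
    h.card_filter_image_bump hN, h.invOn_image_Excp, h.invOn_image_Nexcp, h.apply_place,
    key (fun i z => i < x ∧ a < z), key (fun i z => x < i ∧ z < a)]
  ring

end IsInsertion

section

/-! ### The maps as insertions -/

variable {g ℓ N x : ℕ} {w : ℕ → ℕ}

lemma mem_setA (hw : IsWord N w) {i : ℕ} :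
    i ∈ setA g ℓ (N + 1) w ↔ i ∈ Excp g (g + ℓ) N w ∧ i < ℓ := by
  rw [setA, mem_filter, mem_Icc, Nat.add_sub_cancel]
  constructor
  · rintro ⟨h, hi, hl⟩
    exact ⟨(hw.mem_Excl_apply h.1 h.2).1 hi, hl⟩
  · rintro ⟨hi, hl⟩
    have h := (mem_Excp.1 hi).1
    exact ⟨h, (hw.mem_Excl_apply h.1 h.2).2 hi, hl⟩

lemma mem_setB (hw : IsWord N w) (hn : ℓ ≤ N + 1) {i : ℕ} :
    i ∈ setB g ℓ (N + 1) w ↔ (1 ≤ i ∧ i < ℓ) ∧ i ∉ Excp g (g + ℓ) N w := by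
  rw [setB, mem_filter, mem_Icc, Nat.add_sub_cancel]
  constructor
  · rintro ⟨h, hi, hl⟩
    exact ⟨⟨h.1, hl⟩, fun hX => hi ((hw.mem_Excl_apply h.1 h.2).2 hX)⟩
  · rintro ⟨⟨h1, hl⟩, hi⟩
    have h2 : i ≤ N := by omega
    exact ⟨⟨h1, h2⟩, fun hX => hi ((hw.mem_Excl_apply h1 h2).1 hX), hl⟩

lemma raise_eq (a i : ℕ) : raise g ℓ (N + 1) w a i =
    bump (Excl g (g + ℓ) N w) (N + 1) a (w i) := rfl

lemma raise_of_zero (hw : IsWord N w) (a : ℕ) {i : ℕ} (hi : i = 0 ∨ N < i) :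
    raise g ℓ (N + 1) w a i = 0 := by
  rw [raise_eq, hw.zero i hi, bump_of_notMem]
  intro h
  have := (hw.bounds_of_mem_Excl h).1
  omega

lemma insertionLetter_mem (x : ℕ) : insertionLetter g ℓ (N + 1) w x ∈
    insert (N + 1) (Excl g (g + ℓ) N w) := by
  have := untopD_min_mem ({e ∈ Excl g (g + ℓ) N w | x + (g - 1) ≤ e}) (N + 1)
  rw [mem_insert, mem_filter] at this
  rw [mem_insert]
  exact this.imp id And.left

lemma le_insertionLetter : insertionLetter g ℓ (N + 1) w x = N + 1 ∨
    x + (g - 1) ≤ insertionLetter g ℓ (N + 1) w x := by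
  have := untopD_min_mem ({e ∈ Excl g (g + ℓ) N w | x + (g - 1) ≤ e}) (N + 1)
  rw [mem_insert, mem_filter] at this
  exact this.imp id And.right

lemma insertionLetter_le {e : ℕ} (he : e ∈ Excl g (g + ℓ) N w) (hx : x + (g - 1) ≤ e) :
    insertionLetter g ℓ (N + 1) w x ≤ e :=
  untopD_min_le (N + 1) (mem_filter.2 ⟨he, hx⟩)

lemma firstLetter_mem : firstLetter g ℓ (N + 1) w ∈ insert (N + 1) (Excl g (g + ℓ) N w) :=
  untopD_min_mem (Excl g (g + ℓ) N w) (N + 1)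

lemma firstLetter_le {e : ℕ} (he : e ∈ Excl g (g + ℓ) N w) : firstLetter g ℓ (N + 1) w ≤ e :=
  untopD_min_le (N + 1) he

lemma isInsertion_delta (hg : 1 ≤ g) (hℓ : 1 ≤ ℓ) (hn : g + ℓ ≤ N + 1) (hw : IsWord N w)
    (h1 : ℓ ≤ x) (h2 : x ≤ N + 1) :
    IsInsertion g ℓ N w (Icc ℓ N) x (insertionLetter g ℓ (N + 1) w x)
      (insertBefore (raise g ℓ (N + 1) w (insertionLetter g ℓ (N + 1) w x)) x
        (insertionLetter g ℓ (N + 1) w x)) where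
  gap_pos := hg
  level_pos := hℓ
  le_succ := hn
  word := hw
  bounds i hi := by rw [mem_Icc] at hi; omega
  mem_of_le i h h' := mem_Icc.2 ⟨h, h'⟩
  place_mem := by rw [mem_insert, mem_Icc]; omega
  letter_mem := insertionLetter_mem x
  letter_le i hi _ hx := by
    -- From i ≥ x and w i ≥ i + g follows w i ≥ x + (g - 1), so w i competes in the minimum that
    -- defines the inserted letter.
    have := mem_Excp.1 hi
    exact insertionLetter_le (mem_Excl.2 ⟨i, hi, rfl⟩) (by omega)
  excp := Or.inr fun i _ hi => by rw [mem_Icc]; omega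
  nexcp := Or.inr fun i _ hi => by rw [mem_Icc]; omega
  apply_place := by simp [insertBefore]
  apply_bump i hi1 hi2 := by
    rw [← raise_eq]
    rcases lt_or_ge i x with hi | hi
    · rw [bump_of_lt hi, insertBefore, if_pos hi]
    · rw [bump_of_le (mem_Icc.2 ⟨h1.trans hi, hi2⟩) hi, nextIn_eq (j := i + 1)]
      · rw [insertBefore, if_neg (by omega), if_neg (by omega), Nat.add_sub_cancel]
      · intro t ht; rw [mem_Icc] at ht; omega
      · rw [mem_insert, mem_Icc]; omega
      · omega
      · exact fun t _ ht => ht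
  zero i hi := by
    unfold insertBefore
    split_ifs
    · exact raise_of_zero hw _ (by omega)
    · omega
    · exact raise_of_zero hw _ (by omega)

lemma nextIn_union_Icc {S : Finset ℕ} (hS : ∀ i ∈ S, i < ℓ) (hN : ℓ ≤ N) {i : ℕ} (hi : i < ℓ) :
    nextIn (S ∪ Icc ℓ N) (N + 1) i = nextIn S ℓ i := by
  apply nextIn_eq
  · intro t ht
    rw [mem_union, mem_Icc] at ht
    rcases ht with ht | ht
    · have := hS t ht; omega
    · omega
  · have := nextIn_mem S ℓ i
    rw [mem_insert] at this
    rw [mem_insert, mem_union, mem_Icc]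
    rcases this with h | h
    · rw [h]; omega
    · exact Or.inr (Or.inl h)
  · exact lt_nextIn S hi
  · intro t ht hit
    rw [mem_union, mem_Icc] at ht
    rcases ht with ht | ht
    · exact nextIn_le ℓ ht hit
    · have := nextIn_mem S ℓ i
      rw [mem_insert] at this
      rcases this with h | h
      · rw [h]; omega
      · have := hS _ h; omega

/-- From x on, each letter at a place of S moves to the next place of S and the last one to ℓ, which
pushes everything from ℓ on by one. This is the bump of places for S ∪ [ℓ, N]. The condition `hX`
says that S consists of all low places of one of the two classes. -/
lemma isInsertion_shiftInsert (hg : 1 ≤ g) (hℓ : 1 ≤ ℓ) (hn : g + ℓ ≤ N + 1) (hw : IsWord N w)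
    {S : Finset ℕ} (hS : ∀ i ∈ S, 1 ≤ i ∧ i < ℓ) (hx : x ∈ S)
    (hX : (∀ i ∈ Excp g (g + ℓ) N w, i < ℓ → i ∈ S) ∧
        (∀ i ∈ Nexcp g (g + ℓ) N w, i < ℓ → i ∉ S) ∨
      (∀ i ∈ Excp g (g + ℓ) N w, i < ℓ → i ∉ S) ∧
        (∀ i ∈ Nexcp g (g + ℓ) N w, i < ℓ → i ∈ S)) :
    IsInsertion g ℓ N w (S ∪ Icc ℓ N) x (firstLetter g ℓ (N + 1) w)
      (shiftInsert ℓ S x (firstLetter g ℓ (N + 1) w) (raise g ℓ (N + 1) w 0)) := by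
  have hmem : ∀ i, i ∈ S ∪ Icc ℓ N ↔ i ∈ S ∨ ℓ ≤ i ∧ i ≤ N := by simp
  have hxS := hS x hx
  have hin : ∀ {U : Finset ℕ}, (∀ i ∈ U, i ≤ N) → (∀ i ∈ U, i < ℓ → i ∈ S) →
      ∀ i ∈ U, i ∈ S ∪ Icc ℓ N := fun hU h i hi => by
    rw [hmem]
    rcases lt_or_ge i ℓ with hil | hil
    · exact Or.inl (h i hi hil)
    · exact Or.inr ⟨hil, hU i hi⟩
  have hout : ∀ {U : Finset ℕ}, (∀ i ∈ U, i < ℓ → i ∉ S) →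
      ∀ i ∈ U, i < ℓ → i ∉ S ∪ Icc ℓ N := fun h i hi hil => by
    rw [hmem, not_or]
    exact ⟨h i hi hil, by omega⟩
  have hXN : ∀ i ∈ Excp g (g + ℓ) N w, i ≤ N := fun i hi => (mem_Excp.1 hi).1.2
  have hYN : ∀ i ∈ Nexcp g (g + ℓ) N w, i ≤ N := fun i hi => (mem_Nexcp.1 hi).1.2
  refine
  { gap_pos := hg
    level_pos := hℓ
    le_succ := hn
    word := hw
    bounds := fun i hi => by
      rw [hmem] at hi
      rcases hi with hi | hi
      · have := hS i hi; omega
      · omega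
    mem_of_le := fun i h h' => (hmem i).2 (Or.inr ⟨h, h'⟩)
    place_mem := mem_insert_of_mem ((hmem x).2 (Or.inl hx))
    letter_mem := firstLetter_mem
    letter_le := fun i hi _ _ => firstLetter_le (mem_Excl.2 ⟨i, hi, rfl⟩)
    excp := hX.imp (fun h => hin hXN h.1) (fun h => hout h.1)
    nexcp := hX.symm.imp (fun h => hin hYN h.2) (fun h => hout h.2)
    apply_place := by simp [shiftInsert, insertBefore, hxS.2]
    apply_bump := fun i hi1 hi2 => ?_
    zero := fun i hi => ?_ }
  · have hr : bump (Excl g (g + ℓ) N w) (N + 1) (firstLetter g ℓ (N + 1) w) (w i) =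
        raise g ℓ (N + 1) w 0 i := by
      rw [raise_eq]
      by_cases hE : w i ∈ Excl g (g + ℓ) N w
      · rw [bump_of_le hE (firstLetter_le hE), bump_of_le hE (Nat.zero_le _)]
      · rw [bump_of_notMem hE, bump_of_notMem hE]
    rw [hr]
    rcases lt_or_ge i ℓ with hil | hil
    · by_cases hc : i ∈ S ∧ x ≤ i
      · rw [bump_of_le ((hmem i).2 (Or.inl hc.1)) hc.2,
          nextIn_union_Icc (fun i hi => (hS i hi).2) (by omega) hil]
        have hlt := lt_nextIn S hil
        -- Either i is the last place of S and its letter is inserted at ℓ, or it has a successor in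
        -- S whose predecessor is i.
        rcases mem_insert.1 (nextIn_mem S ℓ i) with hj | hj
        · rw [hj, shiftInsert, insertBefore, if_neg (lt_irrefl _), if_pos rfl]
          congr 1
          apply le_antisymm
          · by_contra hlt'
            have := nextIn_le ℓ (unbotD_max_mem ⟨x, hx⟩ 0) (not_le.1 hlt')
            have := (hS _ (unbotD_max_mem ⟨x, hx⟩ 0)).2
            omega
          · exact le_unbotD_max 0 hc.1
        · have hjl := (hS _ hj).2
          have hi' : i ∈ ({j ∈ S | j < nextIn S ℓ i} : Finset ℕ) := mem_filter.2 ⟨hc.1, hlt⟩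
          rw [shiftInsert, insertBefore, if_pos hjl, if_neg (by omega), if_pos ⟨hj, by omega⟩]
          congr 1
          apply le_antisymm
          · by_contra hlt'
            have hm := mem_filter.1 (unbotD_max_mem ⟨i, hi'⟩ 0)
            have := nextIn_le ℓ hm.1 (not_le.1 hlt')
            omega
          · exact le_unbotD_max 0 hi'
      · rw [bump, if_neg (by rw [hmem]; rintro ⟨h | h, h'⟩; exacts [hc ⟨h, h'⟩, by omega]),
          shiftInsert, insertBefore, if_pos hil, if_neg (by rintro rfl; exact hc ⟨hx, le_rfl⟩),
          if_neg fun h => hc ⟨h.1, h.2.le⟩]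
    · rw [bump_of_le ((hmem i).2 (Or.inr ⟨hil, hi2⟩)) (by omega), nextIn_eq (j := i + 1),
        shiftInsert, insertBefore, if_neg (by omega), if_neg (by omega), Nat.add_sub_cancel,
        if_neg (by omega), if_neg fun h => by have := hS i h.1; omega]
      · intro t ht
        rw [hmem] at ht
        rcases ht with ht | ht
        · have := hS t ht; omega
        · omega
      · rw [mem_insert, hmem]; omega
      · omega
      · exact fun t _ ht => ht
  · rw [shiftInsert, insertBefore]
    have hiS : ∀ j, j = 0 ∨ ℓ ≤ j → ¬ (j ∈ S ∧ x < j) := fun j hj h => by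
      have := hS j h.1; omega
    split_ifs with h1 h2 h3 h4 h5 h6
    · omega
    · exact absurd h3 (hiS i (by omega))
    · exact raise_of_zero hw _ (by omega)
    · omega
    · omega
    · exact absurd h6 (hiS _ (by omega))
    · exact raise_of_zero hw _ (by omega)

lemma isInsertion_setA (hg : 1 ≤ g) (hℓ : 1 ≤ ℓ) (hn : g + ℓ ≤ N + 1) (hw : IsWord N w)
    (hx : x ∈ setA g ℓ (N + 1) w) :
    IsInsertion g ℓ N w (setA g ℓ (N + 1) w ∪ Icc ℓ N) x (firstLetter g ℓ (N + 1) w)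
      (shiftInsert ℓ (setA g ℓ (N + 1) w) x (firstLetter g ℓ (N + 1) w)
        (raise g ℓ (N + 1) w 0)) := by
  refine isInsertion_shiftInsert hg hℓ hn hw (fun i hi => ?_) hx (Or.inl ⟨fun i hi hil => ?_,
    fun i hi _ hiA => ?_⟩)
  · rw [mem_setA hw] at hi
    exact ⟨(mem_Excp.1 hi.1).1.1, hi.2⟩
  · exact (mem_setA hw).2 ⟨hi, hil⟩
  · exact (mem_Nexcp.1 hi).2 ((mem_setA hw).1 hiA).1

lemma isInsertion_setB (hg : 1 ≤ g) (hℓ : 1 ≤ ℓ) (hn : g + ℓ ≤ N + 1) (hw : IsWord N w)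
    (hx : x ∈ setB g ℓ (N + 1) w) :
    IsInsertion g ℓ N w (setB g ℓ (N + 1) w ∪ Icc ℓ N) x (firstLetter g ℓ (N + 1) w)
      (shiftInsert ℓ (setB g ℓ (N + 1) w) x (firstLetter g ℓ (N + 1) w)
        (raise g ℓ (N + 1) w 0)) := by
  have hB := fun i => mem_setB (g := g) (i := i) hw (by omega : ℓ ≤ N + 1)
  refine isInsertion_shiftInsert hg hℓ hn hw (fun i hi => ?_) hx (Or.inr ⟨fun i hi _ hiB => ?_,
    fun i hi hil => ?_⟩)
  · exact ((hB i).1 hi).1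
  · exact ((hB i).1 hiB).2 hi
  · rw [mem_Nexcp] at hi
    exact (hB i).2 ⟨⟨hi.1.1, hil⟩, hi.2⟩

end

section

variable {g ℓ N x : ℕ} {w : ℕ → ℕ}

/-! ### Counting places and letters -/

/-- At a place i ≥ ℓ the gap condition i + g ≤ w i already forces the level g + ℓ. -/
lemma exc_eq (w : ℕ → ℕ) : exc g ℓ N w = ({i ∈ Excp g (g + ℓ) N w | ℓ ≤ i} : Finset ℕ).card := by
  rw [exc]
  congr 1
  ext i
  simp only [mem_filter, mem_Icc, mem_Excp]
  omega

lemma card_Excp_add_card_Nexcp (p : ℕ → Prop) [DecidablePred p] :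
    ({i ∈ Excp g ℓ N w | p i} : Finset ℕ).card + ({i ∈ Nexcp g ℓ N w | p i} : Finset ℕ).card =
      ({i ∈ Icc 1 N | p i} : Finset ℕ).card := by
  rw [← card_union_of_disjoint, ← filter_union]
  · congr 2
    rw [Nexcp, union_sdiff_of_subset]
    exact filter_subset _ _
  · exact disjoint_filter_filter (by rw [Nexcp]; exact disjoint_sdiff)

lemma card_Excp_filter (hw : IsWord N w) (p : ℕ → Prop) [DecidablePred p] :
    ({i ∈ Excp g ℓ N w | p (w i)} : Finset ℕ).card =
      ({e ∈ Excl g ℓ N w | p e} : Finset ℕ).card := by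
  rw [Excl, filter_image, card_image_of_injOn]
  intro i hi j hj h
  have hi := (mem_Excp.1 (mem_filter.1 hi).1).1
  have hj := (mem_Excp.1 (mem_filter.1 hj).1).1
  exact hw.inj i j hi.1 hi.2 hj.1 hj.2 h

lemma IsWord.card_filter_lt (hw : IsWord N w) (a : ℕ) :
    ({i ∈ Icc 1 N | a < w i} : Finset ℕ).card = N - a := by
  have h : ({i ∈ Icc 1 N | a < w i} : Finset ℕ).image w = Icc (a + 1) N := by
    ext z
    simp only [mem_image, mem_filter, mem_Icc]
    constructor
    · rintro ⟨i, ⟨hi, ha⟩, rfl⟩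
      exact ⟨ha, hw.le i hi.1 hi.2⟩
    · rintro ⟨h1, h2⟩
      obtain ⟨i, hi1, hi2, rfl⟩ := hw.surj (by omega : 1 ≤ z) h2
      exact ⟨i, ⟨⟨hi1, hi2⟩, h1⟩, rfl⟩
  have hinj : Set.InjOn w ({i ∈ Icc 1 N | a < w i} : Finset ℕ) := by
    intro i hi j hj h
    have hi := mem_Icc.1 (mem_filter.1 hi).1
    have hj := mem_Icc.1 (mem_filter.1 hj).1
    exact hw.inj i j hi.1 hi.2 hj.1 hj.2 h
  rw [← card_image_of_injOn hinj, h, Nat.card_Icc]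
  omega

/-! ### The labels -/

lemma card_filter_setA_add_setB (hw : IsWord N w) (hn : ℓ ≤ N + 1) (hx : x ≤ ℓ) :
    ({j ∈ setA g ℓ (N + 1) w | j < x} : Finset ℕ).card +
      ({j ∈ setB g ℓ (N + 1) w | j < x} : Finset ℕ).card = x - 1 := by
  rw [← card_union_of_disjoint]
  · have : ({j ∈ setA g ℓ (N + 1) w | j < x} : Finset ℕ) ∪
        ({j ∈ setB g ℓ (N + 1) w | j < x} : Finset ℕ) = Ico 1 x := by
      ext j
      simp only [mem_union, mem_filter, mem_setA hw, mem_setB hw hn, mem_Ico, mem_Excp]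
      omega
    rw [this, Nat.card_Ico]
  · rw [disjoint_left]
    intro j hj hj'
    rw [mem_filter, mem_setA hw] at hj
    rw [mem_filter, mem_setB hw hn] at hj'
    exact hj'.1.2 hj.1.1

lemma card_setA_add_exc (hw : IsWord N w) :
    (setA g ℓ (N + 1) w).card + exc g ℓ N w = (Excl g (g + ℓ) N w).card := by
  rw [exc_eq, hw.card_Excl, ← card_filter_add_card_filter_not (s := Excp g (g + ℓ) N w) (· < ℓ)]
  congr 2
  · ext i; rw [mem_setA hw, mem_filter]
  · exact filter_congr fun i _ => not_lt.symm

lemma card_Excl_le (hw : IsWord N w) : (Excl g (g + ℓ) N w).card ≤ N + 1 - (g + ℓ) := by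
  rw [← Nat.card_Icc]
  refine card_le_card fun e he => ?_
  have := hw.bounds_of_mem_Excl he
  rw [mem_Icc]; omega

lemma label_of_lt (hx : N + 1 - g < x) : label g ℓ (N + 1) w x = N + 1 - x := by
  rw [label, if_pos hx]

lemma label_of_mem_Excl (hg : 1 ≤ g) (hw : IsWord N w)
    (hx : x + (g - 1) ∈ Excl g (g + ℓ) N w) : label g ℓ (N + 1) w x =
      g + ({e ∈ Excl g (g + ℓ) N w | x + (g - 1) < e} : Finset ℕ).card := by
  have := hw.bounds_of_mem_Excl hx
  rw [label, if_neg (by omega), Nat.add_sub_cancel, if_pos hx]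

lemma notMem_Excl_of_lt (hg : 1 ≤ g) (hw : IsWord N w) (hx : x < ℓ) :
    x + (g - 1) ∉ Excl g (g + ℓ) N w := fun h => by
  have := hw.bounds_of_mem_Excl h
  omega

lemma label_of_mem_setB (hg : 1 ≤ g) (hn : g + ℓ ≤ N + 1) (hw : IsWord N w)
    (hx : x ∈ setB g ℓ (N + 1) w) : label g ℓ (N + 1) w x =
      g + (Excl g (g + ℓ) N w).card +
        ({j ∈ setB g ℓ (N + 1) w | j < x} : Finset ℕ).card := by
  have := ((mem_setB hw (by omega)).1 hx).1.2
  rw [label, if_neg (by omega), Nat.add_sub_cancel, if_neg (notMem_Excl_of_lt hg hw this),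
    if_pos hx]

lemma label_of_mem_remainingSpaces (hx : x ∈ remainingSpaces g ℓ (N + 1) w) :
    label g ℓ (N + 1) w x = exc g ℓ N w + g + ℓ - 1 +
      ({j ∈ remainingSpaces g ℓ (N + 1) w | j < x} : Finset ℕ).card := by
  have h := hx
  rw [remainingSpaces, mem_filter, mem_Icc] at h
  rw [label, if_neg (by omega), if_neg h.2.1, if_neg h.2.2, Nat.add_sub_cancel]

lemma mem_remainingSpaces_of_mem_setA (hg : 1 ≤ g) (hn : g + ℓ ≤ N + 1) (hw : IsWord N w)
    (hx : x ∈ setA g ℓ (N + 1) w) : x ∈ remainingSpaces g ℓ (N + 1) w := by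
  have h := (mem_setA hw).1 hx
  have h' := (mem_Excp.1 h.1).1
  rw [remainingSpaces, mem_filter, mem_Icc, Nat.add_sub_cancel, mem_setB hw (by omega)]
  exact ⟨by omega, notMem_Excl_of_lt hg hw h.2, fun hB => hB.2 h.1⟩

lemma mem_remainingSpaces_of_level_le (hℓ : 1 ≤ ℓ) (hn : g + ℓ ≤ N + 1) (hw : IsWord N w)
    (h1 : ℓ ≤ x) (h2 : x ≤ N + 1 - g) (hx : x + (g - 1) ∉ Excl g (g + ℓ) N w) :
    x ∈ remainingSpaces g ℓ (N + 1) w := by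
  rw [remainingSpaces, mem_filter, mem_Icc, Nat.add_sub_cancel, mem_setB hw (by omega)]
  exact ⟨by omega, hx, fun hB => by omega⟩

lemma label_of_mem_setA (hg : 1 ≤ g) (hn : g + ℓ ≤ N + 1) (hw : IsWord N w)
    (hx : x ∈ setA g ℓ (N + 1) w) : label g ℓ (N + 1) w x = exc g ℓ N w + g + ℓ - 1 +
      ({i ∈ Excp g (g + ℓ) N w | i < x} : Finset ℕ).card := by
  rw [label_of_mem_remainingSpaces (mem_remainingSpaces_of_mem_setA hg hn hw hx)]
  congr 2
  have hxl := ((mem_setA hw).1 hx).2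
  ext j
  rw [mem_filter, mem_filter]
  refine and_congr_left fun hj => ⟨fun h => ?_, fun h => ?_⟩
  · rw [remainingSpaces, mem_filter, mem_Icc, mem_setB hw (by omega)] at h
    by_contra hc
    -- A low space that remains is one outside B, hence lies before an excedance place.
    exact h.2.2 ⟨⟨h.1.1, by omega⟩, hc⟩
  · exact mem_remainingSpaces_of_mem_setA hg hn hw ((mem_setA hw).2 ⟨h, by omega⟩)

/-- The remaining spaces before x are those of A and the j in [ℓ, x) with j + (g - 1) not in E.
Their number is |A| + (x - ℓ) minus the number of e in E with e < x + (g - 1). Since |A| + exc =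
|E|, adding exc + g + ℓ - 1 gives this closed form. -/
lemma label_of_level_le (hg : 1 ≤ g) (hℓ : 1 ≤ ℓ) (hn : g + ℓ ≤ N + 1) (hw : IsWord N w)
    (h1 : ℓ ≤ x) (h2 : x ≤ N + 1 - g) (hx : x + (g - 1) ∉ Excl g (g + ℓ) N w) :
    label g ℓ (N + 1) w x = x + g - 1 +
      ({e ∈ Excl g (g + ℓ) N w | x + (g - 1) ≤ e} : Finset ℕ).card := by
  rw [label_of_mem_remainingSpaces (mem_remainingSpaces_of_level_le hℓ hn hw h1 h2 hx)]
  have hA := card_setA_add_exc (g := g) (ℓ := ℓ) hw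
  have hsplit := card_filter_add_card_filter_not (s := Excl g (g + ℓ) N w) (x + (g - 1) ≤ ·)
  have hR : ({j ∈ remainingSpaces g ℓ (N + 1) w | j < x} : Finset ℕ) =
      setA g ℓ (N + 1) w ∪ {j ∈ Ico ℓ x | ¬ j + (g - 1) ∈ Excl g (g + ℓ) N w} := by
    ext j
    rw [mem_union, mem_filter, mem_filter, mem_Ico]
    constructor
    · rintro ⟨hj, hjx⟩
      rw [remainingSpaces, mem_filter, mem_Icc, Nat.add_sub_cancel, mem_setB hw (by omega)] at hj
      rcases lt_or_ge j ℓ with hjl | hjl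
      · left
        rw [mem_setA hw]
        refine ⟨?_, hjl⟩
        by_contra hc
        exact hj.2.2 ⟨⟨hj.1.1, hjl⟩, hc⟩
      · exact Or.inr ⟨⟨hjl, hjx⟩, hj.2.1⟩
    · rintro (hj | ⟨hj, hjE⟩)
      · have := ((mem_setA hw).1 hj).2
        exact ⟨mem_remainingSpaces_of_mem_setA hg hn hw hj, by omega⟩
      · exact ⟨mem_remainingSpaces_of_level_le hℓ hn hw hj.1 (by omega) hjE, hj.2⟩
  have hdisj : Disjoint (setA g ℓ (N + 1) w)
      {j ∈ Ico ℓ x | ¬ j + (g - 1) ∈ Excl g (g + ℓ) N w} := by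
    rw [disjoint_left]
    intro j hj hj'
    have := ((mem_setA hw).1 hj).2
    rw [mem_filter, mem_Ico] at hj'
    omega
  have hcompl := card_filter_add_card_filter_not (s := Ico ℓ x)
    (fun j => j + (g - 1) ∈ Excl g (g + ℓ) N w)
  have hlow : ({j ∈ Ico ℓ x | j + (g - 1) ∈ Excl g (g + ℓ) N w} : Finset ℕ).card =
      ({e ∈ Excl g (g + ℓ) N w | ¬ x + (g - 1) ≤ e} : Finset ℕ).card := by
    refine card_bij (fun j _ => j + (g - 1)) (fun j hj => ?_) (fun _ _ _ _ h => by omega)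
      (fun e he => ?_)
    · rw [mem_filter, mem_Ico] at hj
      rw [mem_filter]
      exact ⟨hj.2, by omega⟩
    · rw [mem_filter] at he
      have := hw.bounds_of_mem_Excl he.1
      refine ⟨e - (g - 1), ?_, by omega⟩
      rw [mem_filter, mem_Ico, Nat.sub_add_cancel (by omega)]
      exact ⟨by omega, he.1⟩
  rw [hR, card_union_of_disjoint hdisj]
  rw [Nat.card_Ico] at hcompl
  omega

lemma card_filter_lt_inj {S : Finset ℕ} {x y : ℕ} (hx : x ∈ S) (hy : y ∈ S)
    (h : ({j ∈ S | j < x} : Finset ℕ).card = ({j ∈ S | j < y} : Finset ℕ).card) : x = y := by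
  have key : ∀ x y, x ∈ S → x < y →
      ({j ∈ S | j < x} : Finset ℕ).card < ({j ∈ S | j < y} : Finset ℕ).card := by
    intro x y hx hxy
    refine card_lt_card ⟨fun j hj => ?_, fun hs => ?_⟩
    · rw [mem_filter] at hj ⊢
      exact ⟨hj.1, hj.2.trans hxy⟩
    · exact lt_irrefl x (mem_filter.1 (hs (mem_filter.2 ⟨hx, hxy⟩))).2
  rcases lt_trichotomy x y with hxy | hxy | hxy
  · exact absurd h (key x y hx hxy).ne
  · exact hxy
  · exact absurd h (key y x hy hxy).ne'

lemma card_filter_gt_inj {S : Finset ℕ} {x y : ℕ} (hx : x ∈ S) (hy : y ∈ S)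
    (h : ({j ∈ S | x < j} : Finset ℕ).card = ({j ∈ S | y < j} : Finset ℕ).card) : x = y := by
  have key : ∀ x y, y ∈ S → x < y →
      ({j ∈ S | y < j} : Finset ℕ).card < ({j ∈ S | x < j} : Finset ℕ).card := by
    intro x y hy hxy
    refine card_lt_card ⟨fun j hj => ?_, fun hs => ?_⟩
    · rw [mem_filter] at hj ⊢
      exact ⟨hj.1, hxy.trans hj.2⟩
    · exact lt_irrefl y (mem_filter.1 (hs (mem_filter.2 ⟨hy, hxy⟩))).2
  rcases lt_trichotomy x y with hxy | hxy | hxy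
  · exact absurd h (key x y hy hxy).ne'
  · exact hxy
  · exact absurd h (key y x hx hxy).ne

lemma card_filter_lt_card {S : Finset ℕ} {x : ℕ} (hx : x ∈ S) {p : ℕ → Prop} [DecidablePred p]
    (hp : ¬ p x) : ({j ∈ S | p j} : Finset ℕ).card < S.card :=
  card_lt_card ⟨filter_subset _ _, fun h => hp (mem_filter.1 (h hx)).2⟩

/-- The four classes of spaces, and the ranges of their labels. -/
lemma label_cases (hg : 1 ≤ g) (hℓ : 1 ≤ ℓ) (hn : g + ℓ ≤ N + 1) (hw : IsWord N w)
    (h1 : 1 ≤ x) (h2 : x ≤ N + 1) :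
    (N + 1 - g < x ∧ label g ℓ (N + 1) w x < g) ∨
    (x + (g - 1) ∈ Excl g (g + ℓ) N w ∧ g ≤ label g ℓ (N + 1) w x ∧
      label g ℓ (N + 1) w x < g + (Excl g (g + ℓ) N w).card) ∨
    (x ∈ setB g ℓ (N + 1) w ∧ g + (Excl g (g + ℓ) N w).card ≤ label g ℓ (N + 1) w x ∧
      label g ℓ (N + 1) w x < exc g ℓ N w + g + ℓ - 1) ∨
    (x ∈ remainingSpaces g ℓ (N + 1) w ∧ exc g ℓ N w + g + ℓ - 1 ≤ label g ℓ (N + 1) w x ∧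
      label g ℓ (N + 1) w x < N + 1) := by
  have hA := card_setA_add_exc (g := g) (ℓ := ℓ) hw
  have hE := card_Excl_le (g := g) (ℓ := ℓ) hw
  by_cases hxg : N + 1 - g < x
  · refine Or.inl ⟨hxg, ?_⟩
    rw [label_of_lt hxg]
    omega
  by_cases hxE : x + (g - 1) ∈ Excl g (g + ℓ) N w
  · refine Or.inr (Or.inl ⟨hxE, ?_⟩)
    rw [label_of_mem_Excl hg hw hxE]
    have := card_filter_lt_card (p := (x + (g - 1) < ·)) hxE (lt_irrefl _)
    omega
  by_cases hxB : x ∈ setB g ℓ (N + 1) w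
  · refine Or.inr (Or.inr (Or.inl ⟨hxB, ?_⟩))
    rw [label_of_mem_setB hg hn hw hxB]
    have h3 := card_filter_lt_card (p := (· < x)) hxB (lt_irrefl x)
    have h4 := card_filter_setA_add_setB (g := g) hw (by omega) (le_refl ℓ)
    rw [filter_true_of_mem fun i hi => ((mem_setA hw).1 hi).2,
      filter_true_of_mem fun i hi => ((mem_setB hw (by omega)).1 hi).1.2] at h4
    omega
  · have hxR : x ∈ remainingSpaces g ℓ (N + 1) w := by
      rw [remainingSpaces, mem_filter, mem_Icc, Nat.add_sub_cancel]
      exact ⟨by omega, hxE, hxB⟩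
    refine Or.inr (Or.inr (Or.inr ⟨hxR, ?_, ?_⟩))
    · rw [label_of_mem_remainingSpaces hxR]
      omega
    rcases lt_or_ge x ℓ with hxl | hxl
    · have hxX : x ∈ Excp g (g + ℓ) N w := by
        by_contra hc
        exact hxB ((mem_setB hw (by omega)).2 ⟨⟨h1, hxl⟩, hc⟩)
      have hxA := (mem_setA hw).2 ⟨hxX, hxl⟩
      rw [label_of_mem_setA hg hn hw hxA]
      have h3 := card_filter_lt_card (p := (· < x)) hxA (lt_irrefl x)
      have h4 : ({i ∈ Excp g (g + ℓ) N w | i < x} : Finset ℕ) =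
          {i ∈ setA g ℓ (N + 1) w | i < x} := by
        ext i
        rw [mem_filter, mem_filter, mem_setA hw, and_assoc]
        refine and_congr_right fun _ => ⟨fun h => ⟨by omega, h⟩, And.right⟩
      rw [h4]
      omega
    · rw [label_of_level_le hg hℓ hn hw hxl (by omega) hxE]
      have h3 : ({e ∈ Excl g (g + ℓ) N w | x + (g - 1) ≤ e} : Finset ℕ) ⊆ Icc (x + g) N := by
        intro e he
        rw [mem_filter] at he
        have := hw.bounds_of_mem_Excl he.1
        have : e ≠ x + (g - 1) := fun h => hxE (h ▸ he.1)
        rw [mem_Icc]; omega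
      have h4 := card_le_card h3
      rw [Nat.card_Icc] at h4
      omega

lemma label_inj (hg : 1 ≤ g) (hℓ : 1 ≤ ℓ) (hn : g + ℓ ≤ N + 1) (hw : IsWord N w)
    {y : ℕ} (hx1 : 1 ≤ x) (hx2 : x ≤ N + 1) (hy1 : 1 ≤ y) (hy2 : y ≤ N + 1)
    (h : label g ℓ (N + 1) w x = label g ℓ (N + 1) w y) : x = y := by
  have hA := card_setA_add_exc (g := g) (ℓ := ℓ) hw
  -- This bound puts the label range of E below that of the remaining spaces, even if B is empty.
  -- Spaces of different classes then have different labels, which settles the mixed cases.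
  have hAl : (setA g ℓ (N + 1) w).card ≤ ℓ - 1 := by
    have h4 := card_filter_setA_add_setB (g := g) hw (by omega) (le_refl ℓ)
    rw [filter_true_of_mem fun i hi => ((mem_setA hw).1 hi).2] at h4
    omega
  rcases label_cases hg hℓ hn hw hx1 hx2 with cx | cx | cx | cx <;>
    rcases label_cases hg hℓ hn hw hy1 hy2 with cy | cy | cy | cy <;> try omega
  · rw [label_of_lt cx.1, label_of_lt cy.1] at h
    omega
  · rw [label_of_mem_Excl hg hw cx.1, label_of_mem_Excl hg hw cy.1] at h
    have := card_filter_gt_inj cx.1 cy.1 (by omega)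
    omega
  · rw [label_of_mem_setB hg hn hw cx.1, label_of_mem_setB hg hn hw cy.1] at h
    exact card_filter_lt_inj cx.1 cy.1 (by omega)
  · rw [label_of_mem_remainingSpaces cx.1, label_of_mem_remainingSpaces cy.1] at h
    exact card_filter_lt_inj cx.1 cy.1 (by omega)

lemma label_lt (hg : 1 ≤ g) (hℓ : 1 ≤ ℓ) (hn : g + ℓ ≤ N + 1) (hw : IsWord N w)
    (hx1 : 1 ≤ x) (hx2 : x ≤ N + 1) : label g ℓ (N + 1) w x < N + 1 := by
  have hA := card_setA_add_exc (g := g) (ℓ := ℓ) hw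
  have hE := card_Excl_le (g := g) (ℓ := ℓ) hw
  rcases label_cases hg hℓ hn hw hx1 hx2 with cx | cx | cx | cx <;> omega

/-- Pigeonhole: distinct labels below n on n spaces exhaust all values. The default value in `space`
is therefore never used. -/
lemma space_spec (hg : 1 ≤ g) (hℓ : 1 ≤ ℓ) (hn : g + ℓ ≤ N + 1) (hw : IsWord N w) {c : ℕ}
    (hc : c < N + 1) : (1 ≤ space g ℓ (N + 1) w c ∧ space g ℓ (N + 1) w c ≤ N + 1) ∧
      label g ℓ (N + 1) w (space g ℓ (N + 1) w c) = c := by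
  have him : (Icc 1 (N + 1)).image (label g ℓ (N + 1) w) = range (N + 1) := by
    apply eq_of_subset_of_card_le
    · intro y hy
      obtain ⟨x, hx, rfl⟩ := mem_image.1 hy
      rw [mem_Icc] at hx
      exact mem_range.2 (label_lt hg hℓ hn hw hx.1 hx.2)
    · rw [card_image_of_injOn, card_range, Nat.card_Icc]
      · omega
      · intro x hx y hy h
        have hx := mem_Icc.1 hx
        have hy := mem_Icc.1 hy
        exact label_inj hg hℓ hn hw hx.1 hx.2 hy.1 hy.2 h
  have hc' : c ∈ (Icc 1 (N + 1)).image (label g ℓ (N + 1) w) := by rw [him]; exact mem_range.2 hc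
  obtain ⟨x, hx, hxc⟩ := mem_image.1 hc'
  have hmem : x ∈ ({x ∈ Icc 1 (N + 1) | label g ℓ (N + 1) w x = c} : Finset ℕ) :=
    mem_filter.2 ⟨hx, hxc⟩
  obtain ⟨m, hm⟩ := min_of_mem hmem
  have hm' := mem_filter.1 (mem_of_min hm)
  rw [mem_Icc] at hm'
  have hs : space g ℓ (N + 1) w c = m := by rw [space, hm]; rfl
  rw [hs]
  exact hm'

end

section

variable {g ℓ N x a : ℕ} {w θ : ℕ → ℕ}

/-! ### The statistics of the images -/

lemma sum_add_indicator (hg : 1 ≤ g) {S : Finset ℕ} {P : ℕ → ℕ} {k : ℕ}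
    (hP : ∀ i ∈ S, P i = if k ≤ i then i + 1 else i) :
    ∑ i ∈ S, (P i + g - 1) = ∑ i ∈ S, (i + g - 1) + ({i ∈ S | k ≤ i} : Finset ℕ).card := by
  rw [card_filter, ← sum_add_distrib]
  refine sum_congr rfl fun i hi => ?_
  rw [hP i hi]
  split_ifs <;> omega

lemma bump_Icc (h : IsInsertion g ℓ N w (Icc ℓ N) x a θ) (hx : ℓ ≤ x) {i : ℕ} (hi : i ≤ N) :
    bump (Icc ℓ N) (N + 1) x i = if x ≤ i then i + 1 else i := by
  rcases lt_or_ge i ℓ with hil | hil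
  · rw [bump_of_lt (by omega), if_neg (by omega)]
  · exact h.bump_of_level_le hil hi

/-- The increase is the number of excedance places from x on plus the number of non-excedances from
x on with letter below a. Every non-excedance letter above a stands at a place from x on, so
subtracting all of them from the non-excedances from x on gives the second number, and the excedance
places cancel. -/
lemma den_delta_of_lt (h : IsInsertion g ℓ N w (Icc ℓ N) x (insertionLetter g ℓ (N + 1) w x) θ)
    (hx : ℓ ≤ x) (hlt : insertionLetter g ℓ (N + 1) w x < x + g) :
    den g (g + ℓ) (N + 1) θ = den g (g + ℓ) N w + label g ℓ (N + 1) w x := by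
  have hg := h.gap_pos
  have hw := h.word
  have hP := fun i (hi : i ≤ N) => bump_Icc h hx hi
  have hXN : ∀ i ∈ Excp g (g + ℓ) N w, i ≤ N := fun i hi => (mem_Excp.1 hi).1.2
  have hYN : ∀ i ∈ Nexcp g (g + ℓ) N w, i ≤ N := fun i hi => (mem_Nexcp.1 hi).1.2
  have hxN := h.place_bounds
  have haN := h.letter_bounds
  have hale := le_insertionLetter (g := g) (ℓ := ℓ) (N := N) (w := w) (x := x)
  have hY : ∀ i ∈ Nexcp g (g + ℓ) N w, insertionLetter g ℓ (N + 1) w x < w i → x ≤ i := by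
    intro i hi hai
    rw [mem_Nexcp, mem_Excp] at hi
    have := hw.le i hi.1.1 hi.1.2
    omega
  have hYne : ∀ i ∈ Nexcp g (g + ℓ) N w, w i ≠ insertionLetter g ℓ (N + 1) w x := by
    intro i hi heq
    rw [mem_Nexcp, ← hw.mem_Excl_apply hi.1.1 hi.1.2, heq] at hi
    rcases mem_insert.1 h.letter_mem with hm | hm
    · have := hw.le i hi.1.1 hi.1.2
      omega
    · exact hi.2 hm
  set a := insertionLetter g ℓ (N + 1) w x with ha
  rw [h.den_of_lt hlt, sum_add_indicator hg fun i hi => hP i (hXN i hi), den]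
  have h1 : ({i ∈ Nexcp g (g + ℓ) N w | bump (Icc ℓ N) (N + 1) x i < x ∧ a < w i} :
      Finset ℕ) = ∅ := by
    refine filter_eq_empty_iff.2 fun i hi hc => ?_
    have := hY i hi hc.2
    rw [hP i (hYN i hi), if_pos this] at hc
    omega
  have h2 : ({i ∈ Nexcp g (g + ℓ) N w | x < bump (Icc ℓ N) (N + 1) x i ∧ w i < a} :
      Finset ℕ) = {i ∈ {i ∈ Nexcp g (g + ℓ) N w | x ≤ i} | ¬ a < w i} := by
    rw [filter_filter]
    refine filter_congr fun i hi => ?_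
    have := hYne i hi
    rw [hP i (hYN i hi)]
    split_ifs <;> omega
  have h3 : ({i ∈ {i ∈ Nexcp g (g + ℓ) N w | x ≤ i} | a < w i} : Finset ℕ) =
      {i ∈ Nexcp g (g + ℓ) N w | a < w i} := by
    rw [filter_filter]
    exact filter_congr fun i hi => ⟨And.right, fun hai => ⟨hY i hi hai, hai⟩⟩
  have h4 := card_filter_add_card_filter_not (s := {i ∈ Nexcp g (g + ℓ) N w | x ≤ i})
    (fun i => a < w i)
  have h5 := card_Excp_add_card_Nexcp (g := g) (ℓ := g + ℓ) (N := N) (w := w) (x ≤ ·)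
  have h6 := card_Excp_add_card_Nexcp (g := g) (ℓ := g + ℓ) (N := N) (w := w) (fun i => a < w i)
  have h7 : ({i ∈ Icc 1 N | x ≤ i} : Finset ℕ) = Icc x N := by
    ext i
    rw [mem_filter, mem_Icc, mem_Icc]
    omega
  rw [hw.card_filter_lt, card_Excp_filter hw (a < ·)] at h6
  rw [h7, Nat.card_Icc] at h5
  rw [h3] at h4
  rw [h1, h2, card_empty]
  -- If a = N + 1, the truncated difference N - a is 0 and x is among the last g spaces; otherwise a
  -- = x + (g - 1).
  have h8 : label g ℓ (N + 1) w x + (N - a) = N + 1 - x +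
      ({e ∈ Excl g (g + ℓ) N w | a < e} : Finset ℕ).card := by
    rcases mem_insert.1 h.letter_mem with hm | hm
    · rw [label_of_lt (by omega), hm, filter_eq_empty_iff.2]
      · rw [card_empty]; omega
      · intro e he
        have := h.letter_lt e he
        omega
    · have haN' := h.letter_lt _ hm
      have hax : x + (g - 1) = a := by omega
      rw [label_of_mem_Excl hg hw (by rwa [hax]), hax]
      omega
  omega

/-- Each old excedance letter e ≥ a counts once: through the shift of its place if that is at least
x, and otherwise through its inversion with a. Excedances from x on all have such letters. The new
place adds x + g - 1. -/
lemma den_delta_of_le (h : IsInsertion g ℓ N w (Icc ℓ N) x (insertionLetter g ℓ (N + 1) w x) θ)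
    (hx : ℓ ≤ x) (hle : x + g ≤ insertionLetter g ℓ (N + 1) w x) :
    den g (g + ℓ) (N + 1) θ = den g (g + ℓ) N w + (x + g - 1 +
      ({e ∈ Excl g (g + ℓ) N w | x + (g - 1) ≤ e} : Finset ℕ).card) := by
  have hg := h.gap_pos
  have hw := h.word
  have hP := fun i (hi : i ≤ N) => bump_Icc h hx hi
  have hX : ∀ i ∈ Excp g (g + ℓ) N w, x ≤ i → insertionLetter g ℓ (N + 1) w x ≤ w i :=
    fun i hi hxi => h.letter_le i hi (hx.trans hxi) hxi
  have hXE : ∀ i ∈ Excp g (g + ℓ) N w, w i ∈ Excl g (g + ℓ) N w := fun i hi =>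
    mem_Excl.2 ⟨i, hi, rfl⟩
  have hiff : ∀ e ∈ Excl g (g + ℓ) N w, (x + (g - 1) ≤ e ↔
      insertionLetter g ℓ (N + 1) w x ≤ e) := fun e he =>
    ⟨insertionLetter_le he, fun hae => by omega⟩
  have hcount : ({e ∈ Excl g (g + ℓ) N w | x + (g - 1) ≤ e} : Finset ℕ).card =
      ({e ∈ Excl g (g + ℓ) N w | insertionLetter g ℓ (N + 1) w x ≤ e} : Finset ℕ).card :=
    congrArg card (filter_congr hiff)
  set a := insertionLetter g ℓ (N + 1) w x with ha
  have hθ : ∀ i ∈ Excp g (g + ℓ) N w, θ (bump (Icc ℓ N) (N + 1) x i) =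
      bump (Excl g (g + ℓ) N w) (N + 1) a (w i) := fun i hi =>
    h.apply_bump i (mem_Excp.1 hi).1.1 (mem_Excp.1 hi).1.2
  rw [h.den_of_le hle, sum_add_indicator hg fun i hi => hP i (mem_Excp.1 hi).1.2, den]
  have h1 : ({i ∈ Excp g (g + ℓ) N w | x < bump (Icc ℓ N) (N + 1) x i ∧
      θ (bump (Icc ℓ N) (N + 1) x i) < a} : Finset ℕ) = ∅ := by
    refine filter_eq_empty_iff.2 fun i hi hc => ?_
    rw [hθ i hi, hP i (mem_Excp.1 hi).1.2] at hc
    have h3 := h.le_bump_letter (w i)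
    split_ifs at hc with hxi
    · have := hX i hi hxi; omega
    · omega
  have h2 : ({i ∈ Excp g (g + ℓ) N w | bump (Icc ℓ N) (N + 1) x i < x ∧
      a < θ (bump (Icc ℓ N) (N + 1) x i)} : Finset ℕ) =
      {i ∈ {i ∈ Excp g (g + ℓ) N w | a ≤ w i} | ¬ x ≤ i} := by
    rw [filter_filter]
    refine filter_congr fun i hi => ?_
    rw [hθ i hi, hP i (mem_Excp.1 hi).1.2]
    have hlt : a < bump (Excl g (g + ℓ) N w) (N + 1) a (w i) ↔ a ≤ w i := by
      rcases lt_or_ge (w i) a with hwa | hwa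
      · rw [bump_of_lt hwa]; omega
      · rw [bump_of_le (hXE i hi) hwa]
        have := lt_nextIn (Excl g (g + ℓ) N w) (h.letter_lt _ (hXE i hi))
        omega
    rw [hlt]
    split_ifs <;> omega
  have h3 : ({i ∈ {i ∈ Excp g (g + ℓ) N w | a ≤ w i} | x ≤ i} : Finset ℕ) =
      {i ∈ Excp g (g + ℓ) N w | x ≤ i} := by
    rw [filter_filter]
    exact filter_congr fun i hi => ⟨And.right, fun hxi => ⟨hX i hi hxi, hxi⟩⟩
  have h4 := card_filter_add_card_filter_not (s := {i ∈ Excp g (g + ℓ) N w | a ≤ w i}) (x ≤ ·)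
  rw [h3, card_Excp_filter hw (a ≤ ·), ← hcount] at h4
  rw [h1, h2, card_empty]
  omega

lemma exc_delta_of_lt (h : IsInsertion g ℓ N w (Icc ℓ N) x a θ) (hx : ℓ ≤ x) (hlt : a < x + g) :
    exc g ℓ (N + 1) θ = exc g ℓ N w := by
  rw [exc_eq, exc_eq, h.Excp_eq_of_lt hlt, h.card_filter_image_bump fun i hi =>
    (mem_Excp.1 hi).1.2]
  congr 1
  refine filter_congr fun i hi => ?_
  rw [bump_Icc h hx (mem_Excp.1 hi).1.2]
  split_ifs <;> omega

lemma exc_delta_of_le (h : IsInsertion g ℓ N w (Icc ℓ N) x a θ) (hx : ℓ ≤ x) (hle : x + g ≤ a) :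
    exc g ℓ (N + 1) θ = exc g ℓ N w + 1 := by
  have hXN : ∀ i ∈ Excp g (g + ℓ) N w, i ≤ N := fun i hi => (mem_Excp.1 hi).1.2
  rw [exc_eq, exc_eq, h.Excp_eq_of_le hle, filter_insert, if_pos hx, card_insert_of_notMem
    fun hc => h.notMem_image hXN (mem_filter.1 hc).1, h.card_filter_image_bump hXN]
  congr 2
  refine filter_congr fun i hi => ?_
  rw [bump_Icc h hx (mem_Excp.1 hi).1.2]
  split_ifs <;> omega

lemma insertionLetter_lt_iff (h : IsInsertion g ℓ N w (Icc ℓ N) x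
      (insertionLetter g ℓ (N + 1) w x) θ) : insertionLetter g ℓ (N + 1) w x < x + g ↔
    N + 1 - g < x ∨ x + (g - 1) ∈ Excl g (g + ℓ) N w := by
  have hg := h.gap_pos
  have hn := h.le_succ
  have haN := h.letter_bounds
  have hale := le_insertionLetter (g := g) (ℓ := ℓ) (N := N) (w := w) (x := x)
  constructor
  · intro hlt
    rcases mem_insert.1 h.letter_mem with hm | hm
    · left; omega
    · right
      have := h.letter_lt _ hm
      rwa [show x + (g - 1) = insertionLetter g ℓ (N + 1) w x by omega]
  · rintro (hx | hx)
    · omega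
    · have := insertionLetter_le hx le_rfl
      omega

lemma den_delta (h : IsInsertion g ℓ N w (Icc ℓ N) x (insertionLetter g ℓ (N + 1) w x) θ)
    (hx : ℓ ≤ x) : den g (g + ℓ) (N + 1) θ = den g (g + ℓ) N w + label g ℓ (N + 1) w x := by
  rcases lt_or_ge (insertionLetter g ℓ (N + 1) w x) (x + g) with hlt | hle
  · exact den_delta_of_lt h hx hlt
  · have hc := mt (insertionLetter_lt_iff h).2 (not_lt.2 hle)
    rw [not_or] at hc
    rw [den_delta_of_le h hx hle, label_of_level_le h.gap_pos h.level_pos h.le_succ h.word hx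
      (by omega) hc.2]

lemma exc_delta (h : IsInsertion g ℓ N w (Icc ℓ N) x (insertionLetter g ℓ (N + 1) w x) θ)
    (hx : ℓ ≤ x) : exc g ℓ (N + 1) θ =
      if label g ℓ (N + 1) w x ≤ exc g ℓ N w + g + ℓ - 2 then exc g ℓ N w
      else exc g ℓ N w + 1 := by
  have hg := h.gap_pos
  have hℓ := h.level_pos
  have hA := card_setA_add_exc (g := g) (ℓ := ℓ) h.word
  have hAl : (setA g ℓ (N + 1) w).card ≤ ℓ - 1 := by
    have hn := h.le_succ
    have h4 := card_filter_setA_add_setB (g := g) h.word (by omega) (le_refl ℓ)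
    rw [filter_true_of_mem fun i hi => ((mem_setA h.word).1 hi).2] at h4
    omega
  have hcases := label_cases h.gap_pos h.level_pos h.le_succ h.word h.place_bounds.1
    h.place_bounds.2
  have hlt := insertionLetter_lt_iff h
  split_ifs with hc
  · refine exc_delta_of_lt h hx (hlt.2 ?_)
    rcases hcases with cx | cx | cx | cx
    · exact Or.inl cx.1
    · exact Or.inr cx.1
    · have hn := h.le_succ
      have := ((mem_setB h.word (by omega)).1 cx.1).1.2
      omega
    · omega
  · refine exc_delta_of_le h hx (not_lt.1 fun hc' => ?_)
    rcases hlt.1 hc' with h' | h'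
    · rw [label_of_lt h'] at hc
      omega
    · rcases hcases with cx | cx | cx | cx
      · omega
      · omega
      · omega
      · have := cx.1
        rw [remainingSpaces, mem_filter] at this
        exact this.2.1 h'

/-- After the bump, every old excedance letter exceeds the inserted first letter. The excedance
inversions with x therefore come exactly from the excedance places left of x, which do not move. -/
lemma card_filter_lt_of_firstLetter {T : Finset ℕ}
    (h : IsInsertion g ℓ N w T x (firstLetter g ℓ (N + 1) w) θ) :
    ({i ∈ Excp g (g + ℓ) N w | bump T (N + 1) x i < x ∧
      firstLetter g ℓ (N + 1) w < θ (bump T (N + 1) x i)} : Finset ℕ) =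
      {i ∈ Excp g (g + ℓ) N w | i < x} ∧
    ({i ∈ Excp g (g + ℓ) N w | x < bump T (N + 1) x i ∧
      θ (bump T (N + 1) x i) < firstLetter g ℓ (N + 1) w} : Finset ℕ) = ∅ := by
  have hlt : ∀ i ∈ Excp g (g + ℓ) N w,
      firstLetter g ℓ (N + 1) w < θ (bump T (N + 1) x i) := by
    intro i hi
    have hi' := (mem_Excp.1 hi).1
    have hE := mem_Excl.2 ⟨i, hi, rfl⟩
    rw [h.apply_bump i hi'.1 hi'.2, bump_of_le hE (firstLetter_le hE)]
    exact (firstLetter_le hE).trans_lt (lt_nextIn _ (h.letter_lt _ hE))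
  constructor
  · refine filter_congr fun i hi => ?_
    have h1 := hlt i hi
    have h2 : i ≤ bump T (N + 1) x i := le_bump h.place_lt
    rcases lt_or_ge i x with hix | hix
    · rw [bump_of_lt hix] at h1 ⊢
      omega
    · omega
  · refine filter_eq_empty_iff.2 fun i hi hc => ?_
    have := hlt i hi
    omega

lemma firstLetter_le_of_lt {T : Finset ℕ}
    (h : IsInsertion g ℓ N w T x (firstLetter g ℓ (N + 1) w) θ) (hx : x < ℓ) :
    x + g ≤ firstLetter g ℓ (N + 1) w := by
  have := h.letter_bounds
  omega

/-- The bump takes A to A ∪ {ℓ} without x. Adding the term of x back restores A together with ℓ, and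
the excedance places from ℓ on shift by one. -/
lemma sum_alpha (h : IsInsertion g ℓ N w (setA g ℓ (N + 1) w ∪ Icc ℓ N) x a θ)
    (hx : x ∈ setA g ℓ (N + 1) w) (f : ℕ → ℕ) :
    ∑ i ∈ Excp g (g + ℓ) N w, f (bump (setA g ℓ (N + 1) w ∪ Icc ℓ N) (N + 1) x i) + f x =
      ∑ i ∈ Excp g (g + ℓ) N w, (if ℓ ≤ i then f (i + 1) else f i) + f ℓ := by
  have hg := h.gap_pos
  have hn := h.le_succ
  have hw := h.word
  have hlt : ∀ i ∈ setA g ℓ (N + 1) w, i < ℓ := fun i hi => ((mem_setA hw).1 hi).2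
  have hX : ({i ∈ Excp g (g + ℓ) N w | ¬ ℓ ≤ i} : Finset ℕ) = setA g ℓ (N + 1) w := by
    ext i
    rw [mem_filter, mem_setA hw, not_le]
  rw [← sum_filter_add_sum_filter_not _ (ℓ ≤ ·),
    ← sum_filter_add_sum_filter_not _ (ℓ ≤ ·) (fun i => if ℓ ≤ i then f (i + 1) else f i), hX,
    add_assoc, add_assoc]
  congr 1
  · refine sum_congr rfl fun i hi => ?_
    rw [mem_filter, mem_Excp] at hi
    have := hlt x hx
    rw [h.bump_of_level_le hi.2 hi.1.1.2, if_pos (by omega), if_pos hi.2]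
  · have hb : ∀ i ∈ setA g ℓ (N + 1) w, bump (setA g ℓ (N + 1) w ∪ Icc ℓ N) (N + 1) x i =
        bump (setA g ℓ (N + 1) w) ℓ x i := by
      intro i hi
      rcases lt_or_ge i x with hix | hix
      · rw [bump_of_lt hix, bump_of_lt hix]
      · rw [bump_of_le (mem_union_left _ hi) hix, bump_of_le hi hix,
          nextIn_union_Icc hlt (by omega) (hlt i hi)]
    have hins : x ∈ insert ℓ (setA g ℓ (N + 1) w) := mem_insert_of_mem hx
    rw [sum_congr rfl fun i hi => by rw [hb i hi],
      ← sum_image (g := bump (setA g ℓ (N + 1) w) ℓ x) (f := f)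
        (fun i hi j hj hij => bump_inj hlt (hlt i hi) (hlt j hj) hij),
      image_bump hlt hins, sum_erase_add _ _ hins, sum_insert fun hc => lt_irrefl _ (hlt ℓ hc),
      add_comm]
    congr 1
    exact sum_congr rfl fun i hi => by rw [if_neg (not_le.2 (hlt i hi))]

lemma den_alpha (h : IsInsertion g ℓ N w (setA g ℓ (N + 1) w ∪ Icc ℓ N) x
      (firstLetter g ℓ (N + 1) w) θ) (hx : x ∈ setA g ℓ (N + 1) w) :
    den g (g + ℓ) (N + 1) θ = den g (g + ℓ) N w + label g ℓ (N + 1) w x := by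
  have hg := h.gap_pos
  have hw := h.word
  have hxl := ((mem_setA hw).1 hx).2
  have hs := sum_alpha h hx (fun i => i + g - 1)
  have hc := card_filter_lt_of_firstLetter h
  have hi := sum_add_indicator (S := Excp g (g + ℓ) N w) (k := ℓ) hg fun i _ => rfl
  rw [← exc_eq] at hi
  rw [h.den_of_le (firstLetter_le_of_lt h hxl), hc.1, hc.2, card_empty,
    label_of_mem_setA hg h.le_succ hw hx, den]
  have hi' : ∑ i ∈ Excp g (g + ℓ) N w, (if ℓ ≤ i then i + 1 + g - 1 else i + g - 1) =
      ∑ i ∈ Excp g (g + ℓ) N w, ((if ℓ ≤ i then i + 1 else i) + g - 1) :=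
    sum_congr rfl fun i _ => by split_ifs <;> rfl
  omega

lemma exc_alpha (h : IsInsertion g ℓ N w (setA g ℓ (N + 1) w ∪ Icc ℓ N) x
      (firstLetter g ℓ (N + 1) w) θ) (hx : x ∈ setA g ℓ (N + 1) w) :
    exc g ℓ (N + 1) θ = if label g ℓ (N + 1) w x ≤ exc g ℓ N w + g + ℓ - 2 then exc g ℓ N w
      else exc g ℓ N w + 1 := by
  have hg := h.gap_pos
  have hℓ := h.level_pos
  have hw := h.word
  have hxl := ((mem_setA hw).1 hx).2
  have hXN : ∀ i ∈ Excp g (g + ℓ) N w, i ≤ N := fun i hi => (mem_Excp.1 hi).1.2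
  -- For the indicator of [ℓ, ∞) the sums count excedance places from ℓ on; the term at ℓ is the
  -- extra one.
  have hs := sum_alpha h hx (fun i => if ℓ ≤ i then 1 else 0)
  rw [if_neg, exc_eq, exc_eq, h.Excp_eq_of_le (firstLetter_le_of_lt h hxl), filter_insert,
    if_neg (not_le.2 hxl), h.card_filter_image_bump hXN, card_filter, card_filter]
  · rw [if_neg (not_le.2 hxl), if_pos le_rfl] at hs
    rw [add_zero] at hs
    rw [hs]
    congr 1
    refine sum_congr rfl fun i _ => ?_
    split_ifs <;> omega
  · rw [label_of_mem_setA hg h.le_succ hw hx]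
    omega

lemma bump_setB (h : IsInsertion g ℓ N w (setB g ℓ (N + 1) w ∪ Icc ℓ N) x a θ)
    (hx : x ∈ setB g ℓ (N + 1) w) {i : ℕ} (hi : i ∈ Excp g (g + ℓ) N w) :
    bump (setB g ℓ (N + 1) w ∪ Icc ℓ N) (N + 1) x i = if ℓ ≤ i then i + 1 else i := by
  have hn := h.le_succ
  have hxl := ((mem_setB h.word (by omega)).1 hx).1.2
  split_ifs with hil
  · rw [h.bump_of_level_le hil (mem_Excp.1 hi).1.2, if_pos (by omega)]
  · refine bump_of_notMem fun hc => ?_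
    rw [mem_union, mem_setB h.word (by omega), mem_Icc] at hc
    rcases hc with hc | hc
    · exact hc.2 hi
    · omega

/-- Low excedances stay put, those from ℓ on shift by one, and the new smallest excedance letter at
x forms an inversion with each place of A to its left. This is not yet the label; the rotation
supplies the difference. -/
lemma den_setB (h : IsInsertion g ℓ N w (setB g ℓ (N + 1) w ∪ Icc ℓ N) x
      (firstLetter g ℓ (N + 1) w) θ) (hx : x ∈ setB g ℓ (N + 1) w) :
    den g (g + ℓ) (N + 1) θ = den g (g + ℓ) N w + (x + g - 1) + exc g ℓ N w +
      ({i ∈ setA g ℓ (N + 1) w | i < x} : Finset ℕ).card := by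
  have hg := h.gap_pos
  have hw := h.word
  have hn := h.le_succ
  have hxl := ((mem_setB hw (by omega)).1 hx).1.2
  have hc := card_filter_lt_of_firstLetter h
  have hA : ({i ∈ Excp g (g + ℓ) N w | i < x} : Finset ℕ) =
      {i ∈ setA g ℓ (N + 1) w | i < x} := by
    ext i
    rw [mem_filter, mem_filter, mem_setA hw, and_assoc]
    refine and_congr_right fun _ => ⟨fun h => ⟨by omega, h⟩, And.right⟩
  rw [h.den_of_le (firstLetter_le_of_lt h hxl), hc.1, hc.2, card_empty,
    sum_add_indicator hg (fun i hi => bump_setB h hx hi), ← exc_eq, den, hA]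
  omega

lemma exc_setB (h : IsInsertion g ℓ N w (setB g ℓ (N + 1) w ∪ Icc ℓ N) x
      (firstLetter g ℓ (N + 1) w) θ) (hx : x ∈ setB g ℓ (N + 1) w) :
    exc g ℓ (N + 1) θ = exc g ℓ N w := by
  have hn := h.le_succ
  have hg := h.gap_pos
  have hxl := ((mem_setB h.word (by omega)).1 hx).1.2
  have hXN : ∀ i ∈ Excp g (g + ℓ) N w, i ≤ N := fun i hi => (mem_Excp.1 hi).1.2
  rw [exc_eq, exc_eq, h.Excp_eq_of_le (firstLetter_le_of_lt h hxl), filter_insert,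
    if_neg (not_le.2 hxl), h.card_filter_image_bump hXN]
  congr 1
  refine filter_congr fun i hi => ?_
  rw [bump_setB h hx hi]
  split_ifs <;> omega

end

section

/-! ### The rotation of the letters to the left of the level -/

/-- The element of `E` before `z`, in the cyclic order of `E`; numbers outside `E` are fixed. -/
def rotateLetter (E : Finset ℕ) (z : ℕ) : ℕ :=
  if z ∈ E then ({e ∈ E | e < z}).max.unbotD (E.max.unbotD 0) else z

section RotateLetter

variable {E : Finset ℕ} {z y m : ℕ}

lemma rotateLetter_of_notMem (hz : z ∉ E) : rotateLetter E z = z := if_neg hz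

lemma rotateLetter_spec (hz : z ∈ E) (hm : m ∈ E) (hmz : m < z) :
    rotateLetter E z ∈ E ∧ rotateLetter E z < z ∧ ∀ e ∈ E, e < z → e ≤ rotateLetter E z := by
  rw [rotateLetter, if_pos hz]
  have := mem_filter.1 (unbotD_max_mem (S := {e ∈ E | e < z}) ⟨m, mem_filter.2 ⟨hm, hmz⟩⟩
    (E.max.unbotD 0))
  exact ⟨this.1, this.2, fun e he hez => le_unbotD_max _ (mem_filter.2 ⟨he, hez⟩)⟩

lemma rotateLetter_min (hz : z ∈ E) (hmin : ∀ e ∈ E, z ≤ e) :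
    rotateLetter E z ∈ E ∧ ∀ e ∈ E, e ≤ rotateLetter E z := by
  have h : ({e ∈ E | e < z} : Finset ℕ) = ∅ :=
    filter_eq_empty_iff.2 fun e he => not_lt.2 (hmin e he)
  rw [rotateLetter, if_pos hz, h, max_empty, WithBot.unbotD_bot]
  exact ⟨unbotD_max_mem ⟨z, hz⟩ 0, fun e he => le_unbotD_max 0 he⟩

lemma rotateLetter_mem (hz : z ∈ E) : rotateLetter E z ∈ E := by
  by_cases h : ∃ m ∈ E, m < z
  · obtain ⟨m, hm, hmz⟩ := h
    exact (rotateLetter_spec hz hm hmz).1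
  · push Not at h
    exact (rotateLetter_min hz h).1

/-- The cyclic shift breaks the order only at the minimum of E, which m < z excludes. -/
lemma rotateLetter_lt (hm : m ∈ E) (hmz : m < z) (hz : z ∈ E) (hy : y ∈ E) (hzy : z < y) :
    rotateLetter E z < rotateLetter E y :=
  (rotateLetter_spec hz hm hmz).2.1.trans_le
    ((rotateLetter_spec hy hz hzy).2.2 z hz hzy)

lemma rotateLetter_ne_of_lt (hz : z ∈ E) (hy : y ∈ E) (hzy : z < y) :
    rotateLetter E z ≠ rotateLetter E y := by
  by_cases h : ∃ m ∈ E, m < z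
  · obtain ⟨m, hm, hmz⟩ := h
    exact (rotateLetter_lt hm hmz hz hy hzy).ne
  · push Not at h
    have h1 := (rotateLetter_min hz h).2 y hy
    have h2 := (rotateLetter_spec hy hz hzy).2.1
    omega

lemma rotateLetter_injective (E : Finset ℕ) : Function.Injective (rotateLetter E) := by
  intro z y h
  by_cases hz : z ∈ E <;> by_cases hy : y ∈ E
  · rcases lt_trichotomy z y with hzy | hzy | hzy
    · exact absurd h (rotateLetter_ne_of_lt hz hy hzy)
    · exact hzy
    · exact absurd h.symm (rotateLetter_ne_of_lt hy hz hzy)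
  · have := rotateLetter_mem hz
    rw [h, rotateLetter_of_notMem hy] at this
    exact absurd this hy
  · have := rotateLetter_mem hy
    rw [← h, rotateLetter_of_notMem hz] at this
    exact absurd this hz
  · rwa [rotateLetter_of_notMem hz, rotateLetter_of_notMem hy] at h

lemma image_rotateLetter (E : Finset ℕ) : E.image (rotateLetter E) = E := by
  apply eq_of_subset_of_card_le
  · intro y hy
    obtain ⟨z, hz, rfl⟩ := mem_image.1 hy
    exact rotateLetter_mem hz
  · rw [card_image_of_injective _ (rotateLetter_injective E)]

end RotateLetter

variable {g ℓ N M x : ℕ} {v w : ℕ → ℕ}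

/-- The excedance letters at places to the left of `ℓ`. -/
def lowLetters (g ℓ M : ℕ) (v : ℕ → ℕ) : Finset ℕ :=
  ({j ∈ Excp g (g + ℓ) M v | j < ℓ}).image v

lemma rotate_eq (i : ℕ) : rotate g ℓ M v i = rotateLetter (lowLetters g ℓ M v) (v i) := rfl

lemma IsWord.apply_mem_lowLetters (hv : IsWord M v) {p : ℕ} :
    v p ∈ lowLetters g ℓ M v ↔ p ∈ Excp g (g + ℓ) M v ∧ p < ℓ := by
  rw [lowLetters, mem_image]
  constructor
  · rintro ⟨j, hj, hjp⟩
    rw [mem_filter] at hj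
    have hj' := (mem_Excp.1 hj.1).1
    have hp : 1 ≤ p ∧ p ≤ M := by
      by_contra hc
      rw [hv.zero p (by omega)] at hjp
      have := hv.pos j hj'.1 hj'.2
      omega
    rwa [← hv.inj j p hj'.1 hj'.2 hp.1 hp.2 hjp]
  · exact fun h => ⟨p, mem_filter.2 h, rfl⟩

lemma rotate_apply_of_le (hv : IsWord M v) {p : ℕ} (hp : ℓ ≤ p) : rotate g ℓ M v p = v p := by
  rw [rotate_eq, rotateLetter_of_notMem]
  rw [hv.apply_mem_lowLetters]
  omega

lemma lowLetters_bounds (hv : IsWord M v) {e : ℕ} (he : e ∈ lowLetters g ℓ M v) :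
    1 ≤ e ∧ e ≤ M ∧ g + ℓ ≤ e := by
  obtain ⟨j, hj, rfl⟩ := mem_image.1 he
  have hj' := mem_Excp.1 (mem_filter.1 hj).1
  exact ⟨hv.pos j hj'.1.1 hj'.1.2, hv.le j hj'.1.1 hj'.1.2, hj'.2.2⟩

lemma isWord_rotate (hv : IsWord M v) : IsWord M (rotate g ℓ M v) := by
  refine ⟨fun i h1 h2 => ?_, fun i h1 h2 => ?_, fun i j h1 h2 h3 h4 h => ?_, fun i hi => ?_⟩
  · rw [rotate_eq]
    by_cases h : v i ∈ lowLetters g ℓ M v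
    · exact (lowLetters_bounds hv (rotateLetter_mem h)).1
    · rw [rotateLetter_of_notMem h]; exact hv.pos i h1 h2
  · rw [rotate_eq]
    by_cases h : v i ∈ lowLetters g ℓ M v
    · exact (lowLetters_bounds hv (rotateLetter_mem h)).2.1
    · rw [rotateLetter_of_notMem h]; exact hv.le i h1 h2
  · exact hv.inj i j h1 h2 h3 h4 (rotateLetter_injective _ h)
  · rw [rotate_eq, hv.zero i hi, rotateLetter_of_notMem]
    intro h
    have := (lowLetters_bounds hv h).1
    omega

/-- Any low excedance letter, being at least g + ℓ, is an excedance at any place left of ℓ. -/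
lemma Excp_rotate (hv : IsWord M v) :
    Excp g (g + ℓ) M (rotate g ℓ M v) = Excp g (g + ℓ) M v := by
  ext p
  by_cases h : v p ∈ lowLetters g ℓ M v
  · have hp := hv.apply_mem_lowLetters.1 h
    have hr := lowLetters_bounds hv (rotateLetter_mem h)
    refine iff_of_true (mem_Excp.2 ⟨(mem_Excp.1 hp.1).1, ?_⟩) hp.1
    rw [rotate_eq]
    omega
  · rw [mem_Excp, mem_Excp, rotate_eq, rotateLetter_of_notMem h]

lemma lowLetters_rotate (hv : IsWord M v) :
    lowLetters g ℓ M (rotate g ℓ M v) = lowLetters g ℓ M v := by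
  rw [lowLetters, Excp_rotate hv]
  conv_rhs => rw [← image_rotateLetter (lowLetters g ℓ M v), lowLetters, image_image]
  rfl

lemma Excl_rotate (hv : IsWord M v) :
    Excl g (g + ℓ) M (rotate g ℓ M v) = Excl g (g + ℓ) M v := by
  apply eq_of_subset_of_card_le
  · intro e he
    rw [mem_Excl, Excp_rotate hv] at he
    obtain ⟨i, hi, rfl⟩ := he
    rw [rotate_eq]
    by_cases h : v i ∈ lowLetters g ℓ M v
    · obtain ⟨j, hj, hji⟩ := mem_image.1 (rotateLetter_mem h)
      exact mem_Excl.2 ⟨j, (mem_filter.1 hj).1, hji⟩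
    · rw [rotateLetter_of_notMem h]
      exact mem_Excl.2 ⟨i, hi, rfl⟩
  · rw [hv.card_Excl, (isWord_rotate hv).card_Excl, Excp_rotate hv]

lemma rotate_injective {v' : ℕ → ℕ} (hv : IsWord M v) (hv' : IsWord M v')
    (h : rotate g ℓ M v = rotate g ℓ M v') : v = v' := by
  -- The rotation permutes the set of low excedance letters, so the image determines which cyclic
  -- shift to undo.
  have hE : lowLetters g ℓ M v = lowLetters g ℓ M v' := by
    rw [← lowLetters_rotate hv, h, lowLetters_rotate hv']
  funext i
  have hi := congrFun h i
  rw [rotate_eq, rotate_eq, hE] at hi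
  exact rotateLetter_injective _ hi

lemma exc_rotate (hv : IsWord M v) : exc g ℓ M (rotate g ℓ M v) = exc g ℓ M v := by
  rw [exc_eq, exc_eq, Excp_rotate hv]

/-- Only inversions between two low excedance places can change. The additive form avoids truncated
subtraction. -/
lemma den_rotate_add (hv : IsWord M v) :
    den g (g + ℓ) M (rotate g ℓ M v) + invOn v {i ∈ Excp g (g + ℓ) M v | i < ℓ} =
      den g (g + ℓ) M v + invOn (rotate g ℓ M v) {i ∈ Excp g (g + ℓ) M v | i < ℓ} := by
  have hY : invOn (rotate g ℓ M v) (Nexcp g (g + ℓ) M v) = invOn v (Nexcp g (g + ℓ) M v) := by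
    refine invOn_congr fun i hi => ?_
    rw [rotate_eq, rotateLetter_of_notMem]
    rw [hv.apply_mem_lowLetters]
    exact fun hc => (mem_Nexcp.1 hi).2 hc.1
  have hinj : ∀ u, IsWord M u → Set.InjOn u ({i ∈ Excp g (g + ℓ) M v | i < ℓ} : Finset ℕ) := by
    intro u hu i hi j hj hij
    have hi := (mem_Excp.1 (mem_filter.1 hi).1).1
    have hj := (mem_Excp.1 (mem_filter.1 hj).1).1
    exact hu.inj i j hi.1 hi.2 hj.1 hj.2 hij
  have hX := invOn_union_add (v := v) (θ := rotate g ℓ M v)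
    (S := {i ∈ Excp g (g + ℓ) M v | i < ℓ}) (U := {i ∈ Excp g (g + ℓ) M v | ¬ i < ℓ})
    (fun i hi j hj => by
      have hi := (mem_filter.1 hi).2
      have hj := (mem_filter.1 hj).2
      omega)
    (fun j hj => rotate_apply_of_le hv (not_lt.1 (mem_filter.1 hj).2))
    (by
      have := lowLetters_rotate (g := g) (ℓ := ℓ) hv
      rwa [lowLetters, lowLetters, Excp_rotate hv] at this)
    (hinj v hv) (hinj _ (isWord_rotate hv))
  rw [filter_union_filter_not_eq] at hX
  have hN : Nexcp g (g + ℓ) M (rotate g ℓ M v) = Nexcp g (g + ℓ) M v := by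
    rw [Nexcp, Nexcp, Excp_rotate hv]
  rw [den, den, Excp_rotate hv, hN, hY]
  omega

lemma Excp_filter_setB (h : IsInsertion g ℓ N w (setB g ℓ (N + 1) w ∪ Icc ℓ N) x
      (firstLetter g ℓ (N + 1) w) v) (hx : x ∈ setB g ℓ (N + 1) w) :
    ({i ∈ Excp g (g + ℓ) (N + 1) v | i < ℓ} : Finset ℕ) = insert x (setA g ℓ (N + 1) w) := by
  have hn := h.le_succ
  have hxl := ((mem_setB h.word (by omega)).1 hx).1.2
  rw [h.Excp_eq_of_le (firstLetter_le_of_lt h hxl), filter_insert, if_pos hxl]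
  congr 1
  ext p
  rw [mem_filter, mem_image, mem_setA h.word]
  constructor
  · rintro ⟨⟨i, hi, rfl⟩, hp⟩
    rw [bump_setB h hx hi] at hp ⊢
    split_ifs at hp ⊢ with hil
    · omega
    · exact ⟨hi, hp⟩
  · rintro ⟨hp, hpl⟩
    exact ⟨⟨p, hp, by rw [bump_setB h hx hp, if_neg (by omega)]⟩, hpl⟩

/-- The letter at x is the smallest low excedance letter and becomes the largest, while those on A
keep their relative order. Inversions with x thus come from the places of A right of x instead of
left of x. With #(A left of x) + #(B left of x) = x - 1 and |A| + exc = |E|, the total increase is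
the label. -/
lemma den_betaStar (h : IsInsertion g ℓ N w (setB g ℓ (N + 1) w ∪ Icc ℓ N) x
      (firstLetter g ℓ (N + 1) w) v) (hx : x ∈ setB g ℓ (N + 1) w) :
    den g (g + ℓ) (N + 1) (rotate g ℓ (N + 1) v) =
      den g (g + ℓ) N w + label g ℓ (N + 1) w x := by
  have hg := h.gap_pos
  have hn := h.le_succ
  have hw := h.word
  have hv := h.isWord
  have hxl := ((mem_setB hw (by omega)).1 hx).1
  have hxA : x ∉ setA g ℓ (N + 1) w := fun hc =>
    ((mem_setB hw (by omega)).1 hx).2 ((mem_setA hw).1 hc).1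
  have hmem : ∀ i ∈ insert x (setA g ℓ (N + 1) w), v i ∈ lowLetters g ℓ (N + 1) v := by
    intro i hi
    rw [← Excp_filter_setB h hx] at hi
    exact hv.apply_mem_lowLetters.2 (mem_filter.1 hi)
  have hlt : ∀ i ∈ setA g ℓ (N + 1) w, v x < v i := by
    intro i hi
    have hi' := (mem_setA hw).1 hi
    have hb := bump_setB h hx hi'.1
    rw [if_neg (by omega)] at hb
    have hE := mem_Excl.2 ⟨i, hi'.1, rfl⟩
    have hiN := (mem_Excp.1 hi'.1).1
    have hvi := h.apply_bump i hiN.1 hiN.2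
    rw [hb, bump_of_le hE (firstLetter_le hE)] at hvi
    rw [h.apply_place, hvi]
    exact (firstLetter_le hE).trans_lt (lt_nextIn _ (h.letter_lt _ hE))
  have hmin : ∀ e ∈ lowLetters g ℓ (N + 1) v, v x ≤ e := by
    intro e he
    rw [lowLetters, Excp_filter_setB h hx] at he
    obtain ⟨i, hi, rfl⟩ := mem_image.1 he
    rcases mem_insert.1 hi with rfl | hi
    · exact le_rfl
    · exact (hlt i hi).le
  have hgt : ∀ i ∈ setA g ℓ (N + 1) w, rotate g ℓ (N + 1) v i < rotate g ℓ (N + 1) v x := by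
    intro i hi
    have h1 := (rotateLetter_min (hmem x (mem_insert_self _ _)) hmin).2 _
      (rotateLetter_mem (hmem i (mem_insert_of_mem hi)))
    have h2 := rotateLetter_ne_of_lt (hmem x (mem_insert_self _ _))
      (hmem i (mem_insert_of_mem hi)) (hlt i hi)
    rw [rotate_eq, rotate_eq]
    omega
  have hinv : invOn (rotate g ℓ (N + 1) v) (setA g ℓ (N + 1) w) =
      invOn v (setA g ℓ (N + 1) w) := by
    have hmono : ∀ i ∈ setA g ℓ (N + 1) w, ∀ j ∈ setA g ℓ (N + 1) w, v i < v j →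
        rotate g ℓ (N + 1) v i < rotate g ℓ (N + 1) v j := fun i hi j hj hij =>
      rotateLetter_lt (hmem x (mem_insert_self _ _)) (hlt i hi) (hmem i (mem_insert_of_mem hi))
        (hmem j (mem_insert_of_mem hj)) hij
    have := invOn_image (w := v) (θ := rotate g ℓ (N + 1) v) (P := id)
      (S := setA g ℓ (N + 1) w) (fun _ _ _ _ hij => hij) (fun i hi j hj => by
        refine ⟨fun hij => ?_, hmono i hi j hj⟩
        by_contra hc
        rcases (not_lt.1 hc).eq_or_lt with heq | hc
        · rw [id, id, rotate_eq, rotate_eq, heq] at hij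
          exact lt_irrefl _ hij
        · exact lt_asymm hij (hmono j hj i hi hc))
    rwa [image_id] at this
  have hd := den_rotate_add (g := g) (ℓ := ℓ) hv
  have hcount : ∀ {p q : ℕ → Prop} [DecidablePred p] [DecidablePred q],
      (∀ i ∈ setA g ℓ (N + 1) w, p i ↔ q i) →
      ({i ∈ setA g ℓ (N + 1) w | p i} : Finset ℕ).card =
        ({i ∈ setA g ℓ (N + 1) w | q i} : Finset ℕ).card :=
    fun hpq => congrArg card (filter_congr hpq)
  have c1 : ({i ∈ setA g ℓ (N + 1) w | i < x ∧ v x < v i} : Finset ℕ).card =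
      ({i ∈ setA g ℓ (N + 1) w | i < x} : Finset ℕ).card :=
    hcount fun i hi => and_iff_left (hlt i hi)
  have c2 : ({i ∈ setA g ℓ (N + 1) w | x < i ∧ v i < v x} : Finset ℕ).card = 0 := by
    rw [card_eq_zero, filter_eq_empty_iff]
    exact fun i hi hc => lt_asymm hc.2 (hlt i hi)
  have c3 : ({i ∈ setA g ℓ (N + 1) w | i < x ∧
      rotate g ℓ (N + 1) v x < rotate g ℓ (N + 1) v i} : Finset ℕ).card = 0 := by
    rw [card_eq_zero, filter_eq_empty_iff]
    exact fun i hi hc => lt_asymm hc.2 (hgt i hi)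
  have c4 : ({i ∈ setA g ℓ (N + 1) w | x < i ∧
      rotate g ℓ (N + 1) v i < rotate g ℓ (N + 1) v x} : Finset ℕ).card =
      ({i ∈ setA g ℓ (N + 1) w | ¬ i < x} : Finset ℕ).card := by
    refine hcount fun i hi => ?_
    have : i ≠ x := fun hc => hxA (hc ▸ hi)
    have := hgt i hi
    omega
  have c5 := card_filter_add_card_filter_not (s := setA g ℓ (N + 1) w) (· < x)
  have c6 := card_filter_setA_add_setB (g := g) hw (by omega) hxl.2.le
  have c7 := card_setA_add_exc (g := g) (ℓ := ℓ) hw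
  rw [Excp_filter_setB h hx, invOn_insert hxA, invOn_insert hxA, hinv, c1, c2, c3, c4,
    den_setB h hx] at hd
  rw [label_of_mem_setB hg hn hw hx]
  omega

lemma exc_betaStar (h : IsInsertion g ℓ N w (setB g ℓ (N + 1) w ∪ Icc ℓ N) x
      (firstLetter g ℓ (N + 1) w) v) (hx : x ∈ setB g ℓ (N + 1) w) :
    exc g ℓ (N + 1) (rotate g ℓ (N + 1) v) =
      if label g ℓ (N + 1) w x ≤ exc g ℓ N w + g + ℓ - 2 then exc g ℓ N w
      else exc g ℓ N w + 1 := by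
  have hg := h.gap_pos
  have hn := h.le_succ
  have hw := h.word
  have hxl := ((mem_setB hw (by omega)).1 hx).1
  have c5 := card_filter_lt_card (p := (· < x)) hx (lt_irrefl x)
  have c6 := card_filter_setA_add_setB (g := g) hw (by omega) (le_refl ℓ)
  rw [filter_true_of_mem fun i hi => ((mem_setA hw).1 hi).2,
    filter_true_of_mem fun i hi => ((mem_setB hw (by omega)).1 hi).1.2] at c6
  have c7 := card_setA_add_exc (g := g) (ℓ := ℓ) hw
  rw [exc_rotate h.isWord, exc_setB h hx, if_pos]
  rw [label_of_mem_setB hg hn hw hx]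
  omega

end

section

variable {g ℓ N M x a : ℕ} {v w w' θ : ℕ → ℕ}

/-! ### Recovering the insertion from the image -/

/-- A place `p ≥ ℓ` whose letter is an excedance letter for the gap `g - 1`, such that all smaller
ones of these letters are less than `p + g - 1`. -/
def IsAnchor (g ℓ M : ℕ) (θ : ℕ → ℕ) (p : ℕ) : Prop :=
  (ℓ ≤ p ∧ p ≤ M) ∧ θ p ∈ Excl (g - 1) (g + ℓ) M θ ∧
    ∀ f ∈ Excl (g - 1) (g + ℓ) M θ, f < θ p → f < p + (g - 1)

lemma Excl_subset (θ : ℕ → ℕ) : Excl g (g + ℓ) M θ ⊆ Excl (g - 1) (g + ℓ) M θ := by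
  intro e he
  obtain ⟨i, hi, rfl⟩ := mem_Excl.1 he
  rw [mem_Excp] at hi
  exact mem_Excl.2 ⟨i, mem_Excp.2 ⟨hi.1, by omega, hi.2.2⟩, rfl⟩

/-- An old excedance letter below a is less than x + (g - 1) by minimality of a. An old
non-excedance can reach the gap g - 1 only if it has not moved, so its place i is less than x and
its letter is i + g - 1. -/
lemma isAnchor_place (h : IsInsertion g ℓ N w (Icc ℓ N) x a θ) (hx : ℓ ≤ x)
    (hxa : x + (g - 1) ≤ a)
    (hmin : ∀ e ∈ Excl g (g + ℓ) N w, x + (g - 1) ≤ e → a ≤ e) : IsAnchor g ℓ (N + 1) θ x := by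
  have hg := h.gap_pos
  have hb := h.place_bounds
  have ha := h.letter_bounds
  refine ⟨⟨hx, hb.2⟩, ?_, fun f hf hfa => ?_⟩
  · rw [h.isWord.mem_Excl_apply hb.1 hb.2, mem_Excp, h.apply_place]
    omega
  · obtain ⟨p, hp, rfl⟩ := mem_Excl.1 hf
    rw [mem_Excp] at hp
    have hpx : p ≠ x := by rintro rfl; exact lt_irrefl _ hfa
    obtain ⟨i, hi, rfl⟩ := h.exists_place hp.1.1 hp.1.2 hpx
    rw [h.apply_place] at hfa
    by_cases hiX : i ∈ Excp g (g + ℓ) N w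
    · have hE := (h.word.mem_Excl_apply hi.1 hi.2).2 hiX
      rw [h.apply_bump i hi.1 hi.2] at hfa ⊢
      have hle := h.le_bump_letter (w i)
      rw [bump_of_lt (by omega)]
      by_contra hc
      have := hmin _ hE (not_lt.1 hc)
      omega
    · rw [h.apply_bump_of_nexcp (mem_Nexcp.2 ⟨hi, hiX⟩)] at hfa hp ⊢
      have hP := bump_Icc h hx hi.2
      rw [mem_Excp] at hiX
      rw [hP] at hp
      split_ifs at hp <;> omega

/-- A letter above a at an anchor p would come from an old place i with p ≤ i + 1. If i is an
excedance, w i was raised, yet w i is still an excedance letter for the gap g - 1 (possibly as a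
itself); the anchor then forces w i < p + (g - 1) ≤ i + g. If i is a non-excedance, it has moved to
i + 1 and misses even the gap g - 1. -/
lemma IsAnchor.apply_le {p : ℕ} (hp : IsAnchor g ℓ (N + 1) θ p)
    (h : IsInsertion g ℓ N w (Icc ℓ N) x a θ) (hx : ℓ ≤ x) (hxa : x + (g - 1) ≤ a) :
    θ p ≤ a := by
  have hg := h.gap_pos
  have hℓ := h.level_pos
  have hb := h.place_bounds
  have hab := h.letter_bounds
  obtain ⟨hpb, hpF, hpmin⟩ := hp
  by_contra hc
  have hpx : p ≠ x := by rintro rfl; exact hc h.apply_place.le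
  have hp1 : 1 ≤ p := by omega
  obtain ⟨i, hi, rfl⟩ := h.exists_place hp1 hpb.2 hpx
  have hP := bump_Icc h hx hi.2
  by_cases hiX : i ∈ Excp g (g + ℓ) N w
  · have hE := (h.word.mem_Excl_apply hi.1 hi.2).2 hiX
    rw [h.apply_bump i hi.1 hi.2] at hc hpmin
    have haw : a ≤ w i := by
      by_contra hlt
      rw [bump_of_lt (not_le.1 hlt)] at hc
      omega
    have hF : w i ∈ Excl (g - 1) (g + ℓ) (N + 1) θ := by
      by_cases heq : w i = a
      · rw [heq, ← h.apply_place, h.isWord.mem_Excl_apply hb.1 hb.2, mem_Excp, h.apply_place]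
        omega
      · apply Excl_subset
        have hmem : w i ∈ (insert (N + 1) (Excl g (g + ℓ) N w)).erase a :=
          mem_erase.2 ⟨heq, mem_insert_of_mem hE⟩
        rcases lt_or_ge a (x + g) with hlt | hle
        · rwa [h.Excl_eq_of_lt hlt]
        · rw [h.Excl_eq_of_le hle]
          exact mem_of_mem_erase hmem
    have hlt := hpmin (w i) hF (by
      rw [bump_of_le hE haw]
      exact lt_nextIn _ (h.letter_lt _ hE))
    have := mem_Excp.1 hiX
    split_ifs at hP <;> omega
  · have hbb := h.bump_bounds hi.1 hi.2
    rw [h.isWord.mem_Excl_apply hbb.1 hbb.2.1, mem_Excp,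
      h.apply_bump_of_nexcp (mem_Nexcp.2 ⟨hi, hiX⟩)] at hpF
    rw [h.apply_bump_of_nexcp (mem_Nexcp.2 ⟨hi, hiX⟩)] at hc
    rw [mem_Excp] at hiX
    split_ifs at hP <;> omega

/-- Either `n` is no excedance letter, and then it is the inserted letter, or the inserted letter
is at an anchor. -/
lemma delta_anchor (h : IsInsertion g ℓ N w (Icc ℓ N) x (insertionLetter g ℓ (N + 1) w x) θ)
    (hx : ℓ ≤ x) :
    (N + 1 ∉ Excl g (g + ℓ) (N + 1) θ ∧ insertionLetter g ℓ (N + 1) w x = N + 1) ∨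
    (N + 1 ∈ Excl g (g + ℓ) (N + 1) θ ∧ IsAnchor g ℓ (N + 1) θ x ∧
      ∀ p, IsAnchor g ℓ (N + 1) θ p → θ p ≤ θ x) := by
  have hg := h.gap_pos
  have hale := le_insertionLetter (g := g) (ℓ := ℓ) (N := N) (w := w) (x := x)
  have hmem : x + (g - 1) ≤ insertionLetter g ℓ (N + 1) w x → IsAnchor g ℓ (N + 1) θ x ∧
      ∀ p, IsAnchor g ℓ (N + 1) θ p → θ p ≤ θ x := fun hxa =>
    ⟨isAnchor_place h hx hxa fun e he => insertionLetter_le he, fun p hp =>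
      (hp.apply_le h hx hxa).trans_eq h.apply_place.symm⟩
  rcases lt_or_ge (insertionLetter g ℓ (N + 1) w x) (x + g) with hlt | hle
  · rw [h.Excl_eq_of_lt hlt, mem_erase]
    by_cases ha : insertionLetter g ℓ (N + 1) w x = N + 1
    · exact Or.inl ⟨fun hc => hc.1 ha.symm, ha⟩
    · exact Or.inr ⟨⟨fun hc => ha hc.symm, mem_insert_self _ _⟩, hmem (by omega)⟩
  · rw [h.Excl_eq_of_le hle]
    exact Or.inr ⟨mem_insert_self _ _, hmem (by omega)⟩

lemma delta_unique {x' : ℕ}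
    (h : IsInsertion g ℓ N w (Icc ℓ N) x (insertionLetter g ℓ (N + 1) w x) θ) (hx : ℓ ≤ x)
    (h' : IsInsertion g ℓ N w' (Icc ℓ N) x' (insertionLetter g ℓ (N + 1) w' x') θ)
    (hx' : ℓ ≤ x') : w = w' ∧ x = x' := by
  have hθ : θ x = θ x' := by
    rcases delta_anchor h hx with ⟨h1, h2⟩ | ⟨h1, h2⟩ <;>
      rcases delta_anchor h' hx' with ⟨h3, h4⟩ | ⟨h3, h4⟩
    · rw [h.apply_place, h'.apply_place, h2, h4]
    · exact absurd h3 h1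
    · exact absurd h1 h3
    · exact le_antisymm (h4.2 x h2.1) (h2.2 x' h4.1)
  have hxx := h.isWord.inj x x' h.place_bounds.1 h.place_bounds.2 h'.place_bounds.1
    h'.place_bounds.2 hθ
  subst hxx
  rw [← h.apply_place.symm.trans h'.apply_place] at h'
  exact ⟨h.word_unique h' (by rw [h.Excl_eq, h'.Excl_eq]), rfl⟩

/-! ### Images under α and β*: absence of anchors, and the place of the inserted letter -/

section FirstLetter

variable {T : Finset ℕ}

/-- Every letter from ℓ on has been pushed there from the left. A raised excedance has its old
letter as a witness against the anchor; a non-excedance misses the gap g - 1 or the level. The word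
θ need only agree with v from ℓ on and have the same excedance letters, which covers v itself and
its rotation. -/
lemma not_isAnchor (h : IsInsertion g ℓ N w T x (firstLetter g ℓ (N + 1) w) v) (hx : x < ℓ)
    (hθ : IsWord (N + 1) θ) (heq : ∀ p, ℓ ≤ p → θ p = v p)
    (hE : Excl g (g + ℓ) (N + 1) θ = Excl g (g + ℓ) (N + 1) v) (p : ℕ) :
    ¬ IsAnchor g ℓ (N + 1) θ p := by
  have hg := h.gap_pos
  have hℓ := h.level_pos
  rintro ⟨hpb, hpF, hpmin⟩
  rw [hθ.mem_Excl_apply (by omega) hpb.2, mem_Excp] at hpF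
  rw [heq p hpb.1] at hpF hpmin
  obtain ⟨i, hi, rfl⟩ := h.exists_place (by omega : 1 ≤ p) hpb.2 (by omega)
  have hP : ℓ ≤ i → bump T (N + 1) x i = i + 1 := fun hil => by
    rw [h.bump_of_level_le hil hi.2, if_pos (by omega)]
  have hP' : i < ℓ → bump T (N + 1) x i ≤ ℓ := h.bump_le_level
  by_cases hiX : i ∈ Excp g (g + ℓ) N w
  · have hwE := (h.word.mem_Excl_apply hi.1 hi.2).2 hiX
    have hF : w i ∈ Excl (g - 1) (g + ℓ) (N + 1) θ := by
      apply Excl_subset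
      rw [hE, h.Excl_eq_of_le (firstLetter_le_of_lt h hx)]
      exact mem_insert_of_mem hwE
    have hlt := hpmin (w i) hF (by
      rw [h.apply_bump i hi.1 hi.2, bump_of_le hwE (firstLetter_le hwE)]
      exact lt_nextIn _ (h.letter_lt _ hwE))
    have := mem_Excp.1 hiX
    rcases lt_or_ge i ℓ with hil | hil
    · have := hP' hil; omega
    · have := hP hil; omega
  · rw [h.apply_bump_of_nexcp (mem_Nexcp.2 ⟨hi, hiX⟩)] at hpF
    rw [mem_Excp] at hiX
    rcases lt_or_ge i ℓ with hil | hil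
    · omega
    · have := hP hil; omega

lemma not_delta (h : IsInsertion g ℓ N w T x (firstLetter g ℓ (N + 1) w) v) (hx : x < ℓ)
    (hθ : IsWord (N + 1) θ) (heq : ∀ p, ℓ ≤ p → θ p = v p)
    (hE : Excl g (g + ℓ) (N + 1) θ = Excl g (g + ℓ) (N + 1) v) {x' : ℕ} (hx' : ℓ ≤ x') :
    ¬ IsInsertion g ℓ N w' (Icc ℓ N) x' (insertionLetter g ℓ (N + 1) w' x') θ := by
  intro h'
  rcases delta_anchor h' hx' with ⟨h1, -⟩ | ⟨-, h2, -⟩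
  · rw [hE, h.Excl_eq_of_le (firstLetter_le_of_lt h hx)] at h1
    exact h1 (mem_insert_self _ _)
  · exact not_isAnchor h hx hθ heq hE x' h2

/-- The inserted letter is the smallest excedance letter of v, so v alone determines it and its
place. -/
lemma place_unique {T' : Finset ℕ} {x' : ℕ}
    (h : IsInsertion g ℓ N w T x (firstLetter g ℓ (N + 1) w) v) (hx : x < ℓ)
    (h' : IsInsertion g ℓ N w' T' x' (firstLetter g ℓ (N + 1) w') v) (hx' : x' < ℓ) :
    x = x' ∧ firstLetter g ℓ (N + 1) w = firstLetter g ℓ (N + 1) w' := by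
  have key : ∀ {w : ℕ → ℕ} {T : Finset ℕ} {x : ℕ},
      IsInsertion g ℓ N w T x (firstLetter g ℓ (N + 1) w) v → x < ℓ →
      v x ∈ Excl g (g + ℓ) (N + 1) v ∧ ∀ e ∈ Excl g (g + ℓ) (N + 1) v, v x ≤ e := by
    intro w T x h hx
    rw [h.Excl_eq_of_le (firstLetter_le_of_lt h hx), h.apply_place]
    refine ⟨firstLetter_mem, fun e he => ?_⟩
    rcases mem_insert.1 he with rfl | he
    · exact h.letter_bounds.2
    · exact firstLetter_le he
  have h1 := key h hx
  have h2 := key h' hx'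
  have heq := le_antisymm (h1.2 _ h2.1) (h2.2 _ h1.1)
  refine ⟨h.isWord.inj x x' h.place_bounds.1 h.place_bounds.2 h'.place_bounds.1
    h'.place_bounds.2 heq, ?_⟩
  rwa [h.apply_place, h'.apply_place] at heq

end FirstLetter

/-- A place that `bump` moves, together with its image, is in the set that is bumped. -/
lemma mem_of_bump_ne {T : Finset ℕ} {n i : ℕ} (h : bump T n x i ≠ i) :
    i ∈ T ∧ (bump T n x i = n ∨ bump T n x i ∈ T) := by
  have hi : i ∈ T := by
    by_contra hc
    exact h (bump_of_notMem hc)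
  exact ⟨hi, mem_insert.1 (bump_mem hi)⟩

lemma Excp_filter_setA (h : IsInsertion g ℓ N w (setA g ℓ (N + 1) w ∪ Icc ℓ N) x
      (firstLetter g ℓ (N + 1) w) v) (hx : x ∈ setA g ℓ (N + 1) w) :
    ({i ∈ Excp g (g + ℓ) (N + 1) v | i < ℓ} : Finset ℕ) = setA g ℓ (N + 1) w := by
  have hg := h.gap_pos
  have hn := h.le_succ
  have hxA := (mem_setA h.word).1 hx
  ext p
  rw [mem_filter]
  by_cases hp : (1 ≤ p ∧ p ≤ N + 1) ∧ p < ℓ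
  · rw [and_iff_left hp.2]
    by_cases hpx : p = x
    · rw [hpx]
      exact iff_of_true (h.place_mem_Excp.2 (firstLetter_le_of_lt h hxA.2)) hx
    · obtain ⟨i, hi, rfl⟩ := h.exists_place hp.1.1 hp.1.2 hpx
      rw [h.bump_mem_Excp hi.1 hi.2]
      by_cases hPi : bump (setA g ℓ (N + 1) w ∪ Icc ℓ N) (N + 1) x i = i
      · rw [hPi] at hp ⊢
        rw [mem_setA h.word, and_iff_left hp.2]
      · have hm := mem_of_bump_ne hPi
        have hle := le_bump (a := x) (z := i) h.place_lt
        rw [mem_union, mem_union, mem_Icc, mem_Icc] at hm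
        refine iff_of_true ?_ ?_
        · exact ((mem_setA h.word).1 (hm.1.resolve_right (by omega))).1
        · exact (hm.2.resolve_left (by omega)).resolve_right (by omega)
  · refine iff_of_false (fun hc => hp ⟨(mem_Excp.1 hc.1).1, hc.2⟩) fun hc => hp ?_
    rw [mem_setA h.word, mem_Excp] at hc
    exact ⟨by omega, hc.2⟩

/-- The letter arriving at ℓ comes from S. Since its class is preserved, ℓ is an excedance place
after α but not after β*; the rotation does not affect this. -/
lemma exists_bump_eq_level {S : Finset ℕ} (h : IsInsertion g ℓ N w (S ∪ Icc ℓ N) x a θ)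
    (hx : x < ℓ) : ∃ i ∈ S, (1 ≤ i ∧ i ≤ N) ∧ bump (S ∪ Icc ℓ N) (N + 1) x i = ℓ := by
  have hg := h.gap_pos
  have hn := h.le_succ
  have hℓ := h.level_pos
  obtain ⟨i, hi, hiℓ⟩ := h.exists_place hℓ (by omega) (by omega : ℓ ≠ x)
  have hil : i < ℓ := by
    by_contra hc
    rw [h.bump_of_level_le (not_lt.1 hc) hi.2] at hiℓ
    split_ifs at hiℓ <;> omega
  have hm := (mem_of_bump_ne (by omega : bump (S ∪ Icc ℓ N) (N + 1) x i ≠ i)).1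
  rw [mem_union, mem_Icc] at hm
  exact ⟨i, hm.resolve_right (by omega), hi, hiℓ⟩

lemma level_mem_Excp (h : IsInsertion g ℓ N w (setA g ℓ (N + 1) w ∪ Icc ℓ N) x a θ)
    (hx : x ∈ setA g ℓ (N + 1) w) : ℓ ∈ Excp g (g + ℓ) (N + 1) θ := by
  obtain ⟨i, hiS, hi, hiℓ⟩ := exists_bump_eq_level h ((mem_setA h.word).1 hx).2
  have := (h.bump_mem_Excp hi.1 hi.2).2 ((mem_setA h.word).1 hiS).1
  rwa [hiℓ] at this

lemma level_notMem_Excp (h : IsInsertion g ℓ N w (setB g ℓ (N + 1) w ∪ Icc ℓ N) x a θ)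
    (hx : x ∈ setB g ℓ (N + 1) w) : ℓ ∉ Excp g (g + ℓ) (N + 1) θ := by
  have hn := h.le_succ
  have hB := fun i => mem_setB (g := g) (i := i) h.word (by omega : ℓ ≤ N + 1)
  obtain ⟨i, hiS, hi, hiℓ⟩ := exists_bump_eq_level h ((hB x).1 hx).1.2
  have := h.bump_mem_Excp hi.1 hi.2
  rw [hiℓ] at this
  exact fun hc => ((hB i).1 hiS).2 (this.1 hc)

lemma alpha_unique {x' : ℕ}
    (h : IsInsertion g ℓ N w (setA g ℓ (N + 1) w ∪ Icc ℓ N) x (firstLetter g ℓ (N + 1) w) v)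
    (hx : x ∈ setA g ℓ (N + 1) w)
    (h' : IsInsertion g ℓ N w' (setA g ℓ (N + 1) w' ∪ Icc ℓ N) x'
      (firstLetter g ℓ (N + 1) w') v) (hx' : x' ∈ setA g ℓ (N + 1) w') : w = w' ∧ x = x' := by
  obtain ⟨rfl, ha⟩ := place_unique h ((mem_setA h.word).1 hx).2 h' ((mem_setA h'.word).1 hx').2
  have hA : setA g ℓ (N + 1) w = setA g ℓ (N + 1) w' := by
    rw [← Excp_filter_setA h hx, Excp_filter_setA h' hx']
  rw [← hA, ← ha] at h'
  exact ⟨h.word_unique h' (by rw [h.Excl_eq, h'.Excl_eq]), rfl⟩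

lemma setB_eq (h : IsInsertion g ℓ N w (setB g ℓ (N + 1) w ∪ Icc ℓ N) x
      (firstLetter g ℓ (N + 1) w) v) (hx : x ∈ setB g ℓ (N + 1) w) :
    setB g ℓ (N + 1) w = insert x (Ico 1 ℓ \ {i ∈ Excp g (g + ℓ) (N + 1) v | i < ℓ}) := by
  have hn := h.le_succ
  have hxB := (mem_setB h.word (by omega)).1 hx
  ext p
  rw [Excp_filter_setB h hx, mem_insert, mem_sdiff, mem_Ico, mem_insert,
    mem_setB h.word (by omega), mem_setA h.word]
  by_cases hpx : p = x
  · rw [hpx]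
    exact iff_of_true hxB (Or.inl rfl)
  · simp only [hpx, false_or]
    refine and_congr_right fun hp => not_congr ?_
    rw [and_iff_left hp.2]

lemma betaStar_unique {x' : ℕ}
    (h : IsInsertion g ℓ N w (setB g ℓ (N + 1) w ∪ Icc ℓ N) x (firstLetter g ℓ (N + 1) w) v)
    (hx : x ∈ setB g ℓ (N + 1) w)
    (h' : IsInsertion g ℓ N w' (setB g ℓ (N + 1) w' ∪ Icc ℓ N) x'
      (firstLetter g ℓ (N + 1) w') v) (hx' : x' ∈ setB g ℓ (N + 1) w') : w = w' ∧ x = x' := by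
  have hn := h.le_succ
  obtain ⟨rfl, ha⟩ := place_unique h ((mem_setB h.word (by omega)).1 hx).1.2 h'
    ((mem_setB h'.word (by omega)).1 hx').1.2
  have hB : setB g ℓ (N + 1) w = setB g ℓ (N + 1) w' := by
    rw [setB_eq h hx, setB_eq h' hx']
  rw [← hB, ← ha] at h'
  exact ⟨h.word_unique h' (by rw [h.Excl_eq, h'.Excl_eq]), rfl⟩

/-! ### The map `ψ` -/

/-- The word `θ` is the image of `w` under one of the three maps, for the space `x`. -/
inductive IsImage (g ℓ N : ℕ) (w : ℕ → ℕ) (x : ℕ) (θ : ℕ → ℕ) : Prop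
  | alpha (hx : x ∈ setA g ℓ (N + 1) w)
      (h : IsInsertion g ℓ N w (setA g ℓ (N + 1) w ∪ Icc ℓ N) x (firstLetter g ℓ (N + 1) w) θ)
  | betaStar (hx : x ∈ setB g ℓ (N + 1) w) (v : ℕ → ℕ)
      (h : IsInsertion g ℓ N w (setB g ℓ (N + 1) w ∪ Icc ℓ N) x (firstLetter g ℓ (N + 1) w) v)
      (hv : θ = rotate g ℓ (N + 1) v)
  | delta (hx : ℓ ≤ x)
      (h : IsInsertion g ℓ N w (Icc ℓ N) x (insertionLetter g ℓ (N + 1) w x) θ)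

lemma isImage_psi (hg : 1 ≤ g) (hℓ : 1 ≤ ℓ) (hn : g + ℓ ≤ N + 1) (hw : IsWord N w) {c : ℕ}
    (hc : c < N + 1) :
    IsImage g ℓ N w (space g ℓ (N + 1) w c) (psi g ℓ (N + 1) w c) := by
  have hs := (space_spec hg hℓ hn hw hc).1
  rw [psi]
  split_ifs with hA hB
  · exact .alpha hA (isInsertion_setA hg hℓ hn hw hA)
  · exact .betaStar hB _ (isInsertion_setB hg hℓ hn hw hB) rfl
  -- Every low place lies in A or in B.
  · have hx : ℓ ≤ space g ℓ (N + 1) w c := by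
      by_contra hx
      rw [mem_setA hw] at hA
      rw [mem_setB hw (by omega)] at hB
      exact hB ⟨⟨hs.1, by omega⟩, fun hX => hA ⟨hX, by omega⟩⟩
    exact .delta hx (isInsertion_delta hg hℓ hn hw hx hs.2)

lemma IsImage.isWord (h : IsImage g ℓ N w x θ) : IsWord (N + 1) θ := by
  rcases h with ⟨_, h⟩ | ⟨_, v, h, rfl⟩ | ⟨_, h⟩
  · exact h.isWord
  · exact isWord_rotate h.isWord
  · exact h.isWord

lemma IsImage.den_eq (h : IsImage g ℓ N w x θ) :
    den g (g + ℓ) (N + 1) θ = den g (g + ℓ) N w + label g ℓ (N + 1) w x := by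
  rcases h with ⟨hx, h⟩ | ⟨hx, v, h, rfl⟩ | ⟨hx, h⟩
  · exact den_alpha h hx
  · exact den_betaStar h hx
  · exact den_delta h hx

lemma IsImage.exc_eq (h : IsImage g ℓ N w x θ) :
    exc g ℓ (N + 1) θ = if label g ℓ (N + 1) w x ≤ exc g ℓ N w + g + ℓ - 2 then exc g ℓ N w
      else exc g ℓ N w + 1 := by
  rcases h with ⟨hx, h⟩ | ⟨hx, v, h, rfl⟩ | ⟨hx, h⟩
  · exact exc_alpha h hx
  · exact exc_betaStar h hx
  · exact exc_delta h hx

lemma IsImage.unique {x' : ℕ} (h : IsImage g ℓ N w x θ) (h' : IsImage g ℓ N w' x' θ) :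
    w = w' ∧ x = x' := by
  have hAD : ∀ {w w' : ℕ → ℕ} {x x' : ℕ}, x ∈ setA g ℓ (N + 1) w →
      IsInsertion g ℓ N w (setA g ℓ (N + 1) w ∪ Icc ℓ N) x (firstLetter g ℓ (N + 1) w) θ →
      ℓ ≤ x' → ¬ IsInsertion g ℓ N w' (Icc ℓ N) x' (insertionLetter g ℓ (N + 1) w' x') θ :=
    fun hx h hx' => not_delta h ((mem_setA h.word).1 hx).2 h.isWord (fun _ _ => rfl) rfl hx'
  have hBD : ∀ {w w' v : ℕ → ℕ} {x x' : ℕ}, x ∈ setB g ℓ (N + 1) w →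
      IsInsertion g ℓ N w (setB g ℓ (N + 1) w ∪ Icc ℓ N) x (firstLetter g ℓ (N + 1) w) v →
      θ = rotate g ℓ (N + 1) v →
      ℓ ≤ x' → ¬ IsInsertion g ℓ N w' (Icc ℓ N) x' (insertionLetter g ℓ (N + 1) w' x') θ := by
    rintro w w' v x x' hx hB rfl hx'
    have hn := hB.le_succ
    exact not_delta hB ((mem_setB hB.word (by omega)).1 hx).1.2 (isWord_rotate hB.isWord)
      (fun _ => rotate_apply_of_le hB.isWord) (Excl_rotate hB.isWord) hx'
  have hAB : ∀ {w w' v : ℕ → ℕ} {x x' : ℕ}, x ∈ setA g ℓ (N + 1) w →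
      IsInsertion g ℓ N w (setA g ℓ (N + 1) w ∪ Icc ℓ N) x (firstLetter g ℓ (N + 1) w) θ →
      x' ∈ setB g ℓ (N + 1) w' →
      IsInsertion g ℓ N w' (setB g ℓ (N + 1) w' ∪ Icc ℓ N) x' (firstLetter g ℓ (N + 1) w') v →
      θ ≠ rotate g ℓ (N + 1) v := by
    rintro w w' v x x' hx hA hx' hB rfl
    have hm := level_mem_Excp hA hx
    rw [Excp_rotate hB.isWord] at hm
    exact level_notMem_Excp hB hx' hm
  rcases h with ⟨hx, h⟩ | ⟨hx, v, h, hv⟩ | ⟨hx, h⟩ <;>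
    rcases h' with ⟨hx', h'⟩ | ⟨hx', v', h', hv'⟩ | ⟨hx', h'⟩
  · exact alpha_unique h hx h' hx'
  · exact absurd hv' (hAB hx h hx' h')
  · exact absurd h' (hAD hx h hx')
  · exact absurd hv (hAB hx' h' hx h)
  · obtain rfl := rotate_injective h.isWord h'.isWord (hv.symm.trans hv')
    exact betaStar_unique h hx h' hx'
  · exact absurd h' (hBD hx h hv hx')
  · exact absurd h (hAD hx' h' hx)
  · exact absurd h (hBD hx' h' hv' hx)
  · exact delta_unique h hx h' hx'

end

end GapDenert

theorem mainTheorem4 (g ℓ n : ℕ) (hg : 1 ≤ g) (hℓ : 1 ≤ ℓ) (hn : g + ℓ ≤ n) :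
    ∃ ψ : Equiv.Perm (Fin (n - 1)) × Fin n → Equiv.Perm (Fin n),
      Function.Bijective ψ ∧
      ∀ (π : Equiv.Perm (Fin (n - 1))) (c : Fin n),
        GapDenert.oneLine (ψ (π, c)) = GapDenert.psi g ℓ n (GapDenert.oneLine π) (c : ℕ) ∧
        GapDenert.exc g ℓ n (GapDenert.oneLine (ψ (π, c))) =
          (if (c : ℕ) ≤ GapDenert.exc g ℓ (n - 1) (GapDenert.oneLine π) + g + ℓ - 2 then
            GapDenert.exc g ℓ (n - 1) (GapDenert.oneLine π)
          else
            GapDenert.exc g ℓ (n - 1) (GapDenert.oneLine π) + 1) ∧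
        GapDenert.den g (g + ℓ) n (GapDenert.oneLine (ψ (π, c))) =
          GapDenert.den g (g + ℓ) (n - 1) (GapDenert.oneLine π) + (c : ℕ) := by
  obtain ⟨N, rfl⟩ : ∃ N, n = N + 1 := ⟨n - 1, by omega⟩
  simp only [Nat.add_sub_cancel]
  have himg : ∀ (π : Equiv.Perm (Fin N)) (c : Fin (N + 1)), _ := fun π c =>
    GapDenert.isImage_psi hg hℓ hn (GapDenert.oneLine_isWord π) c.2
  have hlab : ∀ (π : Equiv.Perm (Fin N)) (c : Fin (N + 1)), _ := fun π c =>
    (GapDenert.space_spec hg hℓ hn (GapDenert.oneLine_isWord π) c.2).2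
  choose ψ hψ using fun (q : Equiv.Perm (Fin N) × Fin (N + 1)) =>
    (himg q.1 q.2).isWord.exists_perm
  refine ⟨ψ, (Fintype.bijective_iff_injective_and_card ψ).2 ⟨?_, ?_⟩, fun π c => ?_⟩
  · rintro ⟨π, c⟩ ⟨ρ, d⟩ h
    have hθ := (hψ (π, c)).symm.trans ((congrArg GapDenert.oneLine h).trans (hψ (ρ, d)))
    have h1 := himg π c
    have h2 := himg ρ d
    simp only at hθ
    rw [hθ] at h1
    obtain ⟨hw, hx⟩ := h1.unique h2
    have hc := hlab π c
    rw [hw] at hc hx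
    -- Equal words and equal spaces give equal labels, hence c = d.
    rw [hx, hlab ρ d] at hc
    rw [GapDenert.oneLine_injective hw, Fin.ext hc]
  · rw [Fintype.card_prod, Fintype.card_perm, Fintype.card_perm, Fintype.card_fin,
      Fintype.card_fin, Nat.factorial_succ, mul_comm]
  · have h1 := (himg π c).exc_eq
    have h2 := (himg π c).den_eq
    rw [hlab π c] at h1 h2
    exact ⟨hψ (π, c), by rw [hψ (π, c)]; exact h1, by rw [hψ (π, c)]; exact h2⟩
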